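/- Let $K$ be a field of characteristic $0$; vector spaces and algebras are over $K$, and algebras need be neither associative nor unital. A Hom-alternative algebra is a triple $(A,\mu,\alpha)$ of a vector space $A$, a bilinear map $\mu:A\times A\to A$ and a linear map $\alpha:A\to A$ such that $\alpha(\mu(x,y))=\mu(\alpha(x),\alpha(y))$ and $as(x,x,y)=as(x,y,y)=0$ for all $x,y\in A$, where $as(x,y,z)=\mu(\mu(x,y),\alpha(z))-\mu(\alpha(x),\mu(y,z))$. A two-sided Hom-ideal is a subspace $I\subseteq A$ with $\mu(A,I)\subseteq I$, $\mu(I,A)\subseteq I$ and $\alpha(I)\subseteq I$. The Hom-alternative algebra $(A,\mu,\alpha)$ is simple if $\alpha\neq0$, $\mu(A,A)\neq\{0\}$ and its only two-sided Hom-ideals are $\{0\}$ and $A$. It is semisimple if $\alpha\ne 0$ and $A=A_1\oplus\cdots\oplus A_p$ with each $A_i$ a simple two-sided Hom-ideal, that is, a two-sided Hom-ideal such that $(A_i,\mu|_{A_i},\alpha|_{A_i})$ is a simple Hom-alternative algebra. Likewise, an alternative algebra $(A,\mu')$ is simple if $\mu'(A,A)\ne\{0\}$ and its only two-sided ideals are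 $\{0\}$ and $A$, and semisimple if it is nonzero and a direct sum of finitely many two-sided ideals each of which is a simple alternative algebra. $(A,\mu,\alpha)$ is of alternative type if there is an alternative algebra $(A,\mu')$ with $\mu=\alpha\circ\mu'$; then $(A,\mu')$ is called an induced alternative algebra of $(A,\mu,\alpha)$. (1) Let $(A,\mu,\alpha)$ be a finite-dimensional semisimple Hom-alternative algebra. Then $\alpha$ is invertible, $(A,\mu,\alpha)$ is of alternative type, and its induced alternative algebra $(A,\mu')$ (which is unique, namely $\mu'=\alpha^{-1}\circ\mu$) is semisimple. (2) Let $(A,\mu')$ be a semisimple alternative algebra (of arbitrary dimension) with a decomposition $A=\bigoplus_{i=1}^s A_i$ into simple two-sided ideals $A_i$, and let $\alpha$ be an automorphism of $(A,\mu')$ with $\alpha(A_i)=A_i$ for $1\le i\le s$. Then $(A,\alpha\circ\mu',\alpha)$ is a semisimple Hom-alternative algebra, $A=\bigoplus_{i=1}^s A_i$ is a decomposition of it into simple two-sided Hom-ideals, and this is its only such decomposition up to the order of the summands. -/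

import Mathlib

namespace HomAlg

section

variable {K : Type*} [Field K] {A : Type*} [AddCommGroup A] [Module K A]

/-! Algebras (not necessarily associative or unital) are given by their bilinear product `μ`. -/

/-- `(A, μ)` is an alternative algebra. -/
structure IsAlternative (μ : A →ₗ[K] A →ₗ[K] A) : Prop where
  left : ∀ x y, μ (μ x x) y = μ x (μ x y)
  right : ∀ x y, μ (μ x y) y = μ x (μ y y)

/-- Two-sided ideals of the algebra `(A, μ)`. -/
structure IsIdeal (μ : A →ₗ[K] A →ₗ[K] A) (I : Submodule K A) : Prop where
  mul_mem_left : ∀ a, ∀ b ∈ I, μ a b ∈ I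
  mul_mem_right : ∀ a, ∀ b ∈ I, μ b a ∈ I

/-- The product of an algebra restricted to a subspace that is closed under it. -/
def restrictMul (μ : A →ₗ[K] A →ₗ[K] A) (I : Submodule K A)
    (h : ∀ a ∈ I, ∀ b ∈ I, μ a b ∈ I) : I →ₗ[K] I →ₗ[K] I :=
  LinearMap.mk₂ K (fun a b => (⟨μ a b, h a a.2 b b.2⟩ : I))
    (fun a b c => Subtype.ext (by simp))
    (fun r a b => Subtype.ext (by simp))
    (fun a b c => Subtype.ext (by simp))
    (fun r a b => Subtype.ext (by simp))

/-- The derived subspace `μ(A, A)`, spanned by all products. -/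
def derived (μ : A →ₗ[K] A →ₗ[K] A) : Submodule K A :=
  Submodule.span K {z | ∃ x y, z = μ x y}

/-- `(A, μ)` is a simple alternative algebra. -/
structure IsSimpleAlternative (μ : A →ₗ[K] A →ₗ[K] A) : Prop where
  alternative : IsAlternative μ
  derived_ne_bot : derived μ ≠ ⊥
  eq_bot_or_eq_top : ∀ I : Submodule K A, IsIdeal μ I → I = ⊥ ∨ I = ⊤

/-- `I` is a two-sided ideal which is simple as an alternative algebra. -/
def IsSimpleIdeal (μ : A →ₗ[K] A →ₗ[K] A) (I : Submodule K A) : Prop :=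
  ∃ h : IsIdeal μ I, IsSimpleAlternative (restrictMul μ I fun a _ b hb => h.mul_mem_left a b hb)

/-- `A = S 1 ⊕ ⋯ ⊕ S p` (internally) with each `S i` a simple two-sided ideal of `(A, μ)`. -/
structure IsSimpleIdealDecomposition (μ : A →ₗ[K] A →ₗ[K] A) {p : ℕ}
    (S : Fin p → Submodule K A) : Prop where
  isInternal : DirectSum.IsInternal S
  simple : ∀ i, IsSimpleIdeal μ (S i)

/-- `(A, μ)` is a semisimple alternative algebra: nonzero, and a finite direct sum of simple
two-sided ideals. -/
structure IsSemisimpleAlternative (μ : A →ₗ[K] A →ₗ[K] A) : Prop where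
  alternative : IsAlternative μ
  nontrivial : Nontrivial A
  exists_decomposition :
    ∃ (p : ℕ) (S : Fin p → Submodule K A), IsSimpleIdealDecomposition μ S

/-! Hom-algebras are given by a bilinear product `μ` and a linear twisting map `α`. -/

/-- The Hom-associator `μ ∘ (μ ⊗ α - α ⊗ μ)`. -/
def homAssociator (μ : A →ₗ[K] A →ₗ[K] A) (α : A →ₗ[K] A) (x y z : A) : A :=
  μ (μ x y) (α z) - μ (α x) (μ y z)

/-- `(A, μ, α)` is a (multiplicative) Hom-alternative algebra. -/
structure IsHomAlternative (μ : A →ₗ[K] A →ₗ[K] A) (α : A →ₗ[K] A) : Prop where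
  multiplicative : ∀ x y, α (μ x y) = μ (α x) (α y)
  left : ∀ x y, homAssociator μ α x x y = 0
  right : ∀ x y, homAssociator μ α x y y = 0

/-- Two-sided Hom-ideals of `(A, μ, α)`. -/
structure IsHomIdeal (μ : A →ₗ[K] A →ₗ[K] A) (α : A →ₗ[K] A) (I : Submodule K A) : Prop where
  mul_mem_left : ∀ a, ∀ b ∈ I, μ a b ∈ I
  mul_mem_right : ∀ a, ∀ b ∈ I, μ b a ∈ I
  twist_mem : ∀ b ∈ I, α b ∈ I

/-- `(A, μ, α)` is a simple Hom-alternative algebra: `α ≠ 0`, `μ(A, A) ≠ 0`, and there is no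
two-sided Hom-ideal besides `0` and `A`. -/
structure IsSimpleHomAlternative (μ : A →ₗ[K] A →ₗ[K] A) (α : A →ₗ[K] A) : Prop where
  homAlternative : IsHomAlternative μ α
  twist_ne_zero : α ≠ 0
  derived_ne_bot : derived μ ≠ ⊥
  eq_bot_or_eq_top : ∀ I : Submodule K A, IsHomIdeal μ α I → I = ⊥ ∨ I = ⊤

/-- `I` is a two-sided Hom-ideal such that `(I, μ|_I, α|_I)` is a simple Hom-alternative
algebra. -/
def IsSimpleHomIdeal (μ : A →ₗ[K] A →ₗ[K] A) (α : A →ₗ[K] A) (I : Submodule K A) : Prop :=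
  ∃ h : IsHomIdeal μ α I,
    IsSimpleHomAlternative (restrictMul μ I fun a _ b hb => h.mul_mem_left a b hb)
      (α.restrict h.twist_mem)

/-- `A = S 1 ⊕ ⋯ ⊕ S p` (internally) with each `S i` a simple two-sided Hom-ideal of
`(A, μ, α)`. -/
structure IsSimpleHomIdealDecomposition (μ : A →ₗ[K] A →ₗ[K] A) (α : A →ₗ[K] A) {p : ℕ}
    (S : Fin p → Submodule K A) : Prop where
  isInternal : DirectSum.IsInternal S
  simple : ∀ i, IsSimpleHomIdeal μ α (S i)

/-- `(A, μ, α)` is a semisimple Hom-alternative algebra: `α ≠ 0`, and `A` is a finite direct sum of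
simple two-sided Hom-ideals. -/
structure IsSemisimpleHomAlternative (μ : A →ₗ[K] A →ₗ[K] A) (α : A →ₗ[K] A) : Prop where
  homAlternative : IsHomAlternative μ α
  twist_ne_zero : α ≠ 0
  exists_decomposition :
    ∃ (p : ℕ) (S : Fin p → Submodule K A), IsSimpleHomIdealDecomposition μ α S

/-- `(A, μ')` is a compatible (induced) alternative algebra of `(A, μ, α)`: it is alternative and
`μ = α ∘ μ'`. -/
structure IsInducedAlternative (μ : A →ₗ[K] A →ₗ[K] A) (α : A →ₗ[K] A)
    (μ' : A →ₗ[K] A →ₗ[K] A) : Prop where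
  alternative : IsAlternative μ'
  eq_comp : ∀ x y, μ x y = α (μ' x y)

/-- `(A, μ, α)` is of alternative type. -/
def IsOfAlternativeType (μ : A →ₗ[K] A →ₗ[K] A) (α : A →ₗ[K] A) : Prop :=
  ∃ μ' : A →ₗ[K] A →ₗ[K] A, IsInducedAlternative μ α μ'

end

end HomAlg

/-!
The two halves of the theorem are of different depth.

Let `(A, μ, α)` be finite-dimensional and semisimple. The kernel of `α` meets each simple Hom-ideal
`S i` in a Hom-ideal, hence trivially, so `α` is bijective and can be undone:
`μ' = α⁻¹ ∘ μ` is alternative and `α` is an automorphism of it. It permutes the minimal ideals of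
`(A, μ')` inside the `S i`, so their sum is a Hom-ideal that meets every `S i`, and is `A`. Distinct
minimal ideals annihilate each other. A minimal ideal with zero multiplication would therefore
annihilate `A`, but the annihilator of `A` meets `S i` trivially. It follows that the minimal ideals
are independent and simple (`IsAlternative.exists_isSimpleIdealDecomposition`,
`IsSemisimpleHomAlternative.isSemisimpleAlternative`).

Conversely, let `α` be an automorphism of a simple alternative algebra `A` of any dimension, and
`J ≠ 0` a Hom-ideal for the twisted product. The union of the preimages of `J` under the powers of
`α` is an ideal for the untwisted product, hence all of `A`, so any element is moved into `J` by a
power of `α`. This does not suffice for `J = A` if `α` has infinite order, but it does if there is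
a nonzero `n` in the nucleus: the ideal generated by such an `n` is spanned by products `n`,
`x * n`, `n * x` and `x * n * y` of bounded length, and `J` contains all of these for
`α (α n)` in place of `n`, once it contains `n`
(`IsSimpleAlg.eq_bot_or_eq_top_of_twist`). Uniqueness of the decomposition holds because two simple
Hom-ideals are equal or meet trivially, and in the latter case annihilate each other.

The main point is thus that a simple alternative algebra in characteristic zero has a nonzero
nucleus (`IsSimpleAlg.exists_nuclear`). Suppose that the nucleus is zero.

* The fourth power of a commutator is nuclear (`IsAlt.commutator_pow_four_nuclear`), hence zero.
* There is no `b ≠ 0` with `b * (x * b) = 0` for all `x` (`eq_zero_of_mul_mul_self`). For a null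
  pair `s, c`, such as `b, b` if `b * b = 0`, the map `(y, z) ↦ s * (c, y, z)` is a skew biderivation
  with a cyclic symmetry. Commutation with one of its values is then a derivation, which makes the
  value nuclear, so the map is zero. With this, null pairs are stable under left multiplication
  (`IsNullPair.mul_left`), so that `b` lies in a left ideal `S` of mutual null pairs, and `S + S * A`
  is a nonzero ideal with zero multiplication, contrary to simplicity.
* If `a * a = 0`, then the fourth power of `[a, y]` applied to `a` is the word `a y a y a y a y a`,
  so all these words vanish. Linearization in `y` produces shorter words `e` with
  `e * (z * e) = 0` for all `z`, which vanish in turn, and finally `a = 0`.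

Hence the fourth powers of commutators being zero, the commutators themselves are. A commutative
alternative ring without `3`-torsion is associative, so its nucleus is everything, a contradiction.
-/

/-! ### Associators and Kleinfeld's function -/

namespace Alternative

variable {A : Type*} [NonUnitalNonAssocRing A]

/-- The alternative laws, for a ring that need be neither associative nor unital. -/
structure IsAlt (A : Type*) [NonUnitalNonAssocRing A] : Prop where
  left : ∀ x y : A, associator x x y = 0
  right : ∀ x y : A, associator x y y = 0

/-- Kleinfeld's function, which measures how far the associator `(·, y, z)` is from satisfying the
Leibniz rule for the opposite product. It is alternating in an alternative ring. -/
def kleinfeld (w x y z : A) : A :=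
  associator (w * x) y z - x * associator w y z - associator x y z * w

theorem associator_add_left (a b x y : A) :
    associator (a + b) x y = associator a x y + associator b x y := by
  simp only [associator_apply, add_mul]; abel

theorem associator_add_mid (a b x y : A) :
    associator x (a + b) y = associator x a y + associator x b y := by
  simp only [associator_apply, add_mul, mul_add]; abel

theorem associator_add_right (a b x y : A) :
    associator x y (a + b) = associator x y a + associator x y b := by
  simp only [associator_apply, mul_add]; abel

theorem associator_sub_left (a b x y : A) :
    associator (a - b) x y = associator a x y - associator b x y := by
  simp only [associator_apply, sub_mul]; abel

theorem associator_sub_right (a b x y : A) :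
    associator x y (a - b) = associator x y a - associator x y b := by
  simp only [associator_apply, mul_sub]; abel

theorem associator_neg_left (a x y : A) : associator (-a) x y = - associator a x y := by
  simp only [associator_apply, neg_mul]; abel

theorem associator_mul_left (w x y z : A) :
    associator (w * x) y z =
      kleinfeld w x y z + x * associator w y z + associator x y z * w := by
  rw [kleinfeld]; abel

namespace IsAlt

theorem swap₁₂ (h : IsAlt A) (x y z : A) : associator y x z = - associator x y z := by
  have e := h.left (x + y) z
  rw [associator_add_left, associator_add_mid, associator_add_mid, h.left, h.left] at e
  linear_combination (norm := abel) e

theorem swap₂₃ (h : IsAlt A) (x y z : A) : associator x z y = - associator x y z := by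
  have e := h.right x (y + z)
  rw [associator_add_right, associator_add_mid, associator_add_mid, h.right, h.right] at e
  linear_combination (norm := abel) e

theorem cycle (h : IsAlt A) (x y z : A) : associator y z x = associator x y z := by
  rw [h.swap₂₃ y x z, h.swap₁₂ x y z, neg_neg]

theorem cycle' (h : IsAlt A) (x y z : A) : associator x y z = associator y z x :=
  (h.cycle x y z).symm

theorem swap₁₃ (h : IsAlt A) (x y z : A) : associator z y x = - associator x y z := by
  rw [h.swap₂₃ z x y, h.cycle y z x, h.cycle x y z]

theorem flexible (h : IsAlt A) (x y : A) : associator x y x = 0 := by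
  rw [h.swap₂₃, h.left, neg_zero]

theorem kleinfeld_swap₃₄ (h : IsAlt A) (w x y z : A) :
    kleinfeld w x z y = - kleinfeld w x y z := by
  simp only [kleinfeld, h.swap₂₃ _ y z, mul_neg, neg_mul]; abel

/-- The Teichmüller identity makes Kleinfeld's function anti-invariant under the four-cycle. -/
theorem kleinfeld_cycle (h : IsAlt A) (w x y z : A) :
    kleinfeld z w x y = - kleinfeld w x y z := by
  have e₁ := associator_cocycle w x y z
  have e₂ := associator_cocycle x y z w
  rw [h.cycle (y * z) w x, ← h.cycle w (x * y) z] at e₁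
  rw [h.cycle (z * w) x y, ← h.cycle x (y * z) w, h.cycle w y z] at e₂
  simp only [kleinfeld, ← h.cycle z x y]
  linear_combination (norm := abel) - e₁ - e₂

theorem kleinfeld_swap_pairs (h : IsAlt A) (w x y z : A) :
    kleinfeld y z w x = kleinfeld w x y z := by
  rw [h.kleinfeld_cycle z w x y, h.kleinfeld_cycle w x y z, neg_neg]

theorem kleinfeld_swap₁₂ (h : IsAlt A) (w x y z : A) :
    kleinfeld x w y z = - kleinfeld w x y z := by
  rw [← h.kleinfeld_swap_pairs x w, h.kleinfeld_swap₃₄, h.kleinfeld_swap_pairs]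

theorem kleinfeld_swap₂₃ (h : IsAlt A) (w x y z : A) :
    kleinfeld w y x z = - kleinfeld w x y z := by
  rw [← neg_neg (kleinfeld w y x z), ← h.kleinfeld_cycle, h.kleinfeld_swap₃₄, h.kleinfeld_cycle,
    neg_neg]

/-- Cyclically permuting the last three arguments of Kleinfeld's function does nothing. -/
theorem kleinfeld_cycle₃ (h : IsAlt A) (w x y z : A) :
    kleinfeld w y z x = kleinfeld w x y z := by
  rw [h.kleinfeld_swap₃₄ w y x z, h.kleinfeld_swap₂₃, neg_neg]

/-- Kleinfeld's function in terms of commutators. -/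
theorem kleinfeld_eq (h : IsAlt A) (w x y z : A) :
    kleinfeld w x y z =
      associator (w * x - x * w) y z + associator (y * z - z * y) w x := by
  have e₁ := associator_cocycle w x y z
  have c₁ := h.kleinfeld_swap₁₂ w x y z
  have c₂ := h.kleinfeld_swap₁₂ y z w x
  have c₃ := h.kleinfeld_swap_pairs w x y z
  have c₅ := h.kleinfeld_cycle x y z w
  rw [h.cycle (y * z) w x, ← h.cycle w (x * y) z] at e₁
  simp only [kleinfeld, associator_sub_left] at *
  have t₁ : associator z w x = associator w x z := by rw [← h.cycle z w x]
  have t₂ : associator y w x = associator w x y := by rw [← h.cycle y w x]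
  have t₅ := h.cycle w x z
  rw [t₁, t₂] at c₂
  rw [t₁, t₂] at c₃
  rw [t₅, h.cycle w y z] at c₅
  linear_combination (norm := abel) c₁ + c₂ - c₃ - c₅ + e₁

theorem left_alternative (h : IsAlt A) (x y : A) : x * x * y = x * (x * y) :=
  sub_eq_zero.1 (h.left x y)

theorem right_alternative (h : IsAlt A) (x y : A) : x * y * y = x * (y * y) :=
  sub_eq_zero.1 (h.right x y)

theorem flexible_mul (h : IsAlt A) (x y : A) : x * y * x = x * (y * x) :=
  sub_eq_zero.1 (h.flexible x y)

/-- The commutator with `z` satisfies the Leibniz rule up to three times the associator. -/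
theorem three_associator (h : IsAlt A) (x y z : A) :
    x * y * z - z * (x * y) - x * (y * z - z * y) - (x * z - z * x) * y =
      associator x y z + associator x y z + associator x y z := by
  have e₁ := h.swap₂₃ x y z
  have e₂ := h.cycle z x y
  simp only [associator_apply, mul_sub, sub_mul] at *
  linear_combination (norm := abel) -e₁ - e₂

theorem kleinfeld_self₃₄ (h : IsAlt A) (w x y : A) : kleinfeld w x y y = 0 := by
  simp only [kleinfeld, h.right, mul_zero, zero_mul, sub_zero]

theorem kleinfeld_self₁₂ (h : IsAlt A) (x y z : A) : kleinfeld x x y z = 0 := by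
  rw [← h.kleinfeld_swap_pairs, h.kleinfeld_self₃₄]

/-- If the operator `(b, n, ·)` vanishes, then so does Kleinfeld's function at `b, n`. -/
theorem kleinfeld_eq_zero (h : IsAlt A) {b n : A} (hb : ∀ t, associator b n t = 0) (z t : A) :
    kleinfeld z b n t = 0 := by
  have hb' : ∀ u, associator u b n = 0 := fun u => by rw [← h.cycle, hb]
  rw [← neg_neg (kleinfeld z b n t), ← h.kleinfeld_cycle]
  simp only [kleinfeld, hb', mul_zero, zero_mul, sub_zero, neg_zero]

/-- If the operator `(b, n, ·)` vanishes, then the map `(·, n, t)` turns multiplication by `b` on one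
side into multiplication by `b` on the other side. -/
theorem associator_mul_of_associator_eq_zero (h : IsAlt A) {b n : A}
    (hb : ∀ t, associator b n t = 0) (z t : A) :
    associator (z * b) n t = b * associator z n t := by
  rw [associator_mul_left, h.kleinfeld_eq_zero hb, hb, zero_mul, zero_add, add_zero]

theorem associator_mul_of_associator_eq_zero' (h : IsAlt A) {b n : A}
    (hb : ∀ t, associator b n t = 0) (z t : A) :
    associator (b * z) n t = associator z n t * b := by
  rw [associator_mul_left, h.kleinfeld_swap₁₂, h.kleinfeld_eq_zero hb, hb, mul_zero, neg_zero,
    zero_add, zero_add]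

/-! ### The Moufang identities -/

/-- Left Moufang identity. -/
theorem moufang_left (h : IsAlt A) (x y z : A) : x * y * x * z = x * (y * (x * z)) := by
  have e₁ : associator (x * y) x z = associator y x z * x :=
    h.associator_mul_of_associator_eq_zero' (h.left x) y z
  have e₂ : associator (x * z) x y = associator z x y * x :=
    h.associator_mul_of_associator_eq_zero' (h.left x) z y
  rw [← h.cycle (x * z) x y, h.cycle' z x y] at e₂
  rw [h.swap₁₂ x y z, neg_mul] at e₁
  simp only [associator_apply x y (x * z), associator_apply (x * y) x z] at *
  linear_combination (norm := abel) e₁ + e₂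

/-- Middle Moufang identity. -/
theorem moufang_middle (h : IsAlt A) (x y z : A) : x * y * (z * x) = x * (y * z) * x := by
  have e₁ : associator (z * x) x y = x * associator z x y :=
    h.associator_mul_of_associator_eq_zero (h.left x) z y
  rw [← h.cycle (z * x) x y, h.cycle' z x y, h.cycle' x y z, associator_apply, associator_apply,
    mul_sub] at e₁
  rw [h.flexible_mul]
  linear_combination (norm := abel) e₁

/-! ### Nuclearity of fourth powers of commutators -/

/-- The commutator `[x, y]` anticommutes with every associator `(z, x, y)`. -/
theorem commutator_associator (h : IsAlt A) (x y z : A) :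
    (x * y - y * x) * associator z x y + associator z x y * (x * y - y * x) = 0 := by
  have Dx : ∀ z, associator (z * x) x y = x * associator z x y := fun z =>
    h.associator_mul_of_associator_eq_zero (h.left x) z y
  have Dx' : ∀ z, associator (x * z) x y = associator z x y * x := fun z =>
    h.associator_mul_of_associator_eq_zero' (h.left x) z y
  have Dy : ∀ z, associator (z * y) x y = y * associator z x y := fun z => by
    rw [h.swap₂₃ _ y x, h.associator_mul_of_associator_eq_zero (h.left y), h.swap₂₃ z x y,
      mul_neg, neg_neg]
  have Dy' : ∀ z, associator (y * z) x y = associator z x y * y := fun z => by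
    rw [h.swap₂₃ _ y x, h.associator_mul_of_associator_eq_zero' (h.left y), h.swap₂₃ z x y,
      neg_mul, neg_neg]
  have hxy : associator (x * y) x y = 0 := by rw [Dx', h.flexible, zero_mul]
  set d := associator z x y with hd
  -- Compare the expansions of `(d, x, y)` that result from `d = (z * x) * y - z * (x * y)` and from
  -- `d = (x * y) * z - x * (y * z)`.
  have e₁ : associator (z * (x * y)) x y = kleinfeld z (x * y) x y + (x * y) * d := by
    rw [associator_mul_left, hxy, zero_mul, add_zero]
  have e₂ : associator (x * y * z) x y = - kleinfeld z (x * y) x y + d * (x * y) := by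
    rw [associator_mul_left, hxy, mul_zero, add_zero, h.kleinfeld_swap₁₂]
  have e₃ : associator d x y = y * (x * d) - associator (z * (x * y)) x y := by
    conv_lhs => rw [hd, associator_apply z x y, associator_sub_left, Dy, Dx]
  have e₄ : associator d x y = associator (x * y * z) x y - d * y * x := by
    conv_lhs => rw [hd, h.cycle' z x y, associator_apply x y z, associator_sub_left, Dx', Dy']
  have e₅ : associator y x d = - associator d x y := by rw [h.swap₁₂, h.cycle' d x y]
  have e₆ : associator d y x = - associator d x y := h.swap₂₃ _ _ _
  simp only [associator_apply y, associator_apply d y, mul_sub, sub_mul] at *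
  linear_combination (norm := abel) e₃ - e₄ - e₁ - e₂ - e₅ + e₆

/-- The square of a commutator `[x, y]` associates with `x`. -/
theorem commutator_sq_associator_left (h : IsAlt A) (x y t : A) :
    associator ((x * y - y * x) * (x * y - y * x)) x t = 0 := by
  have e₁ : associator (x * y) x t = associator y x t * x :=
    h.associator_mul_of_associator_eq_zero' (h.left x) y t
  have e₂ : associator (y * x) x t = x * associator y x t :=
    h.associator_mul_of_associator_eq_zero (h.left x) y t
  have e₃ : associator (t * x) x y = x * associator t x y :=
    h.associator_mul_of_associator_eq_zero (h.left x) t y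
  have e₄ : associator (x * t) x y = associator t x y * x :=
    h.associator_mul_of_associator_eq_zero' (h.left x) t y
  have e₅ : associator (x * y - y * x) x t = associator (t * x - x * t) x y := by
    rw [associator_sub_left, associator_sub_left, e₁, e₂, e₃, e₄, h.swap₁₂ x y, h.cycle' t x y,
      neg_mul, mul_neg]
    abel
  rw [associator_mul_left, h.kleinfeld_self₁₂, zero_add, e₅, h.commutator_associator]

theorem commutator_sq_associator_right (h : IsAlt A) (x y t : A) :
    associator ((x * y - y * x) * (x * y - y * x)) y t = 0 := by
  have := h.commutator_sq_associator_left y x t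
  rwa [← neg_sub (x * y) (y * x), neg_mul_neg] at this

/-- The key to the nuclearity of fourth powers of commutators: `[x, y]` annihilates the
associators `(z, [x, y]², t)`. -/
theorem commutator_mul_associator_sq (h : IsAlt A) (x y z t : A) :
    (x * y - y * x) * associator z ((x * y - y * x) * (x * y - y * x)) t = 0 ∧
      associator z ((x * y - y * x) * (x * y - y * x)) t * (x * y - y * x) = 0 := by
  set n := (x * y - y * x) * (x * y - y * x) with hn
  have hx : ∀ t, associator x n t = 0 := fun t => by
    rw [h.swap₁₂ n, h.commutator_sq_associator_left, neg_zero]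
  have hy : ∀ t, associator y n t = 0 := fun t => by
    rw [h.swap₁₂ n, h.commutator_sq_associator_right, neg_zero]
  have hxy : ∀ t, associator (x * y) n t = 0 := fun t => by
    rw [h.associator_mul_of_associator_eq_zero hy, hx, mul_zero]
  set g := associator z n t with hg
  -- The map `(·, n, t)` turns multiplication by `x`, `y` and `x * y` into the opposite one, so it
  -- can be evaluated at `(z, x, y) = (x, y, z) = -(x, z, y)` in three ways.
  have e₁ : associator (associator z x y) n t = y * (x * g) - x * y * g := by
    rw [associator_apply z x y, associator_sub_left, h.associator_mul_of_associator_eq_zero hy,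
      h.associator_mul_of_associator_eq_zero hx, h.associator_mul_of_associator_eq_zero hxy]
  have e₂ : associator (associator x y z) n t = g * (x * y) - g * y * x := by
    rw [associator_apply x y z, associator_sub_left, h.associator_mul_of_associator_eq_zero' hxy,
      h.associator_mul_of_associator_eq_zero' hx, h.associator_mul_of_associator_eq_zero' hy]
  have e₃ : associator (associator x z y) n t = y * (g * x) - y * g * x := by
    rw [associator_apply x z y, associator_sub_left, h.associator_mul_of_associator_eq_zero hy,
      h.associator_mul_of_associator_eq_zero' hx, h.associator_mul_of_associator_eq_zero' hx,
      h.associator_mul_of_associator_eq_zero hy]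
  rw [h.cycle' z x y] at e₁
  rw [h.swap₂₃ x y z, associator_neg_left] at e₃
  have e₄ := h.swap₂₃ y x g
  have e₅ := h.cycle g y x
  simp only [associator_apply y, associator_apply g y] at e₄ e₅
  simp only [sub_mul, mul_sub]
  constructor
  · linear_combination (norm := abel) e₁ + e₃ - e₄
  · linear_combination (norm := abel) - e₂ - e₃ - e₅ + e₄

/-- The fourth power of a commutator lies in the nucleus. -/
theorem commutator_pow_four_nuclear (h : IsAlt A) (x y z t : A) :
    associator ((x * y - y * x) * (x * y - y * x) * ((x * y - y * x) * (x * y - y * x))) z t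
      = 0 := by
  obtain ⟨e₁, e₂⟩ := h.commutator_mul_associator_sq x y z t
  set v := x * y - y * x
  rw [associator_mul_left, h.kleinfeld_self₁₂, h.swap₁₂ z, mul_neg, neg_mul,
    h.left_alternative, e₁, mul_zero, ← h.right_alternative, e₂, zero_mul]
  simp

end IsAlt

/-! ### Null pairs -/

/-- Kleinfeld's identity makes `(s, v, ·)` a derivation as soon as `s` and `v` commute. -/
theorem IsAlt.associator_mul_of_commute (h : IsAlt A) {s v : A} (hsv : s * v = v * s) (x y : A) :
    associator s v (x * y) = x * associator s v y + associator s v x * y := by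
  have e := h.kleinfeld_eq y x s v
  rw [hsv, sub_self, associator_sub_left, kleinfeld, associator_apply 0, zero_mul, zero_mul,
    zero_mul, sub_zero, add_zero] at e
  rw [h.cycle (x * y) s v, h.cycle x s v, h.cycle y s v]
  linear_combination (norm := abel) e

/-- `s` and `c` form a null pair if the products `s * c`, `s * (c * x)`, `s * (x * c)`,
`(s * x) * c`, `(x * s) * c` and those with `s` and `c` interchanged vanish. For an alternative ring
it suffices to ask for the following ones, with an associator in place of `s * (c * x)`. -/
structure IsNullPair (s c : A) : Prop where
  mul : s * c = 0
  mul' : c * s = 0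
  assoc : ∀ x, associator s c x = 0
  outer : ∀ x, s * (x * c) = 0
  outer' : ∀ x, c * (x * s) = 0

namespace IsNullPair

theorem symm (h : IsAlt A) {s c : A} (p : IsNullPair s c) : IsNullPair c s :=
  ⟨p.mul', p.mul, fun x => by rw [h.swap₁₂, p.assoc, neg_zero], p.outer', p.outer⟩

theorem add {s c d : A} (p : IsNullPair s c) (q : IsNullPair s d) : IsNullPair s (c + d) :=
  ⟨by rw [mul_add, p.mul, q.mul, add_zero], by rw [add_mul, p.mul', q.mul', add_zero],
    fun x => by rw [associator_add_mid, p.assoc, q.assoc, add_zero],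
    fun x => by rw [mul_add, mul_add, p.outer, q.outer, add_zero],
    fun x => by rw [add_mul, p.outer', q.outer', add_zero]⟩

theorem smul {K : Type*} [Field K] [Module K A] [IsScalarTower K A A] [SMulCommClass K A A]
    (k : K) {s c : A} (p : IsNullPair s c) : IsNullPair s (k • c) :=
  ⟨by rw [mul_smul_comm, p.mul, smul_zero], by rw [smul_mul_assoc, p.mul', smul_zero],
    fun x => by
      have := p.assoc x
      rw [associator_apply] at *
      rw [mul_smul_comm, smul_mul_assoc, smul_mul_assoc, mul_smul_comm, ← smul_sub, this,
        smul_zero],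
    fun x => by rw [mul_smul_comm, mul_smul_comm, p.outer, smul_zero],
    fun x => by rw [smul_mul_assoc, p.outer', smul_zero]⟩

variable {s c : A}

theorem mul_mul (p : IsNullPair s c) (x : A) : s * (c * x) = 0 := by
  have := p.assoc x
  rwa [associator_apply, p.mul, zero_mul, zero_sub, neg_eq_zero] at this

theorem mul_mul_right (h : IsAlt A) (p : IsNullPair s c) (x : A) : x * s * c = 0 := by
  have := h.cycle x s c
  rwa [p.assoc, eq_comm, associator_apply, p.mul, mul_zero, sub_zero] at this

theorem mul_mul_outer (h : IsAlt A) (p : IsNullPair s c) (x : A) : s * x * c = 0 := by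
  have := h.swap₂₃ s c x
  rwa [p.assoc, neg_zero, associator_apply, p.outer, sub_zero] at this

theorem associator_mul_mul (p : IsNullPair s c) (y z : A) :
    associator s (c * y) z = - (s * associator c y z) := by
  rw [associator_apply, p.mul_mul, associator_apply, mul_sub, p.mul_mul, zero_mul, sub_zero,
    zero_sub]

/-- The Leibniz rule of the map `(y, z) ↦ s * (c, y, z)` in the second variable. -/
theorem mul_associator_mul_right (h : IsAlt A) (p : IsNullPair s c) (y a b : A) :
    s * associator c y (a * b) = a * (s * associator c y b) + s * associator c y a * b := by
  have := h.associator_mul_of_commute (s := s) (v := c * y)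
    (by rw [p.mul_mul, (p.symm h).mul_mul_outer h]) a b
  simp only [p.associator_mul_mul, mul_neg, neg_mul] at this
  linear_combination (norm := abel) - this

theorem mul_associator_mul_left (h : IsAlt A) (p : IsNullPair s c) (y a b : A) :
    s * associator c (a * b) y = a * (s * associator c b y) + s * associator c a y * b := by
  simp only [h.swap₂₃ c y, mul_neg, neg_mul]
  rw [p.mul_associator_mul_right h]
  abel

/-- The cyclic identity for the skew biderivation `(y, z) ↦ s * (c, y, z)`. -/
theorem mul_associator_cyclic (h : IsAlt A) (p : IsNullPair s c) (x y z : A) :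
    s * associator c (x * y) z + s * associator c (y * z) x + s * associator c (z * x) y = 0 := by
  have e₁ := congrArg (s * ·) (associator_cocycle x y z c)
  have e₂ : associator x y (z * c) = kleinfeld z c x y + c * associator z x y
      + associator c x y * z := by rw [← h.cycle x y, ← h.cycle, associator_mul_left]
  have e₃ : associator c (z * x) y = kleinfeld z c x y + x * associator z y c
      + associator c x y * z := by
    rw [← h.cycle, associator_mul_left, h.kleinfeld_cycle₃, h.cycle c x y]
  have e₄ : associator z y c = - associator c y z := h.swap₁₃ _ _ _
  have e₅ : associator y z c = associator c y z := h.cycle _ _ _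
  have e₆ : associator (x * y) z c = associator c (x * y) z := h.cycle _ _ _
  have e₇ : associator x (y * z) c = - associator c (y * z) x := h.swap₁₃ _ _ _
  rw [e₂, e₅, e₆, e₇] at e₁
  rw [e₃, e₄]
  simp only [mul_add, mul_sub, mul_neg, p.outer, p.mul_mul, mul_zero] at e₁ ⊢
  linear_combination (norm := abel) -e₁

/-- If the nucleus is zero, then `s * (c, y, z) = 0` for a null pair `s, c`: the commutator with
this element is a derivation, which makes it nuclear. -/
theorem mul_associator (h : IsAlt A) (h3 : ∀ x : A, x + x + x = 0 → x = 0)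
    (hN : ∀ n : A, (∀ y z, associator n y z = 0) → n = 0) (p : IsNullPair s c) (y z : A) :
    s * associator c y z = 0 := by
  refine hN _ fun x w => h3 _ ?_
  set P := s * associator c y z with hP
  have key : ∀ x, x * P - P * x = s * associator c x (y * z - z * y) := fun x => by
    have e := p.mul_associator_cyclic h x y z
    rw [p.mul_associator_mul_left h, p.mul_associator_mul_left h, p.mul_associator_mul_left h] at e
    rw [associator_sub_right, mul_sub, p.mul_associator_mul_right h, p.mul_associator_mul_right h]
    rw [h.swap₂₃ c x y, h.swap₂₃ c x z, h.swap₂₃ c y z] at e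
    simp only [mul_neg, neg_mul, ← hP] at *
    linear_combination (norm := abel) e
  have e := h.three_associator x w P
  rw [key w, key x, key (x * w), p.mul_associator_mul_left h] at e
  rw [← h.cycle, ← e]
  abel

/-- The products of a null pair `s, c` with two more factors vanish. -/
theorem mul_mul_mul (h : IsAlt A) (h3 : ∀ x : A, x + x + x = 0 → x = 0)
    (hN : ∀ n : A, (∀ y z, associator n y z = 0) → n = 0) (p : IsNullPair s c) (x y : A) :
    s * x * (c * y) = 0 ∧ s * (x * (c * y)) = 0 ∧ s * (c * x * y) = 0 ∧
      s * (x * c * y) = 0 := by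
  have P : ∀ y z, s * associator c y z = 0 := p.mul_associator h h3 hN
  have Q : ∀ y z, c * associator s y z = 0 := (p.symm h).mul_associator h h3 hN
  have R : ∀ y z, associator c y z * s = 0 := fun y z => by
    have e := associator_mul_left s c y z
    have h₀ : associator 0 y z = 0 := by rw [associator_apply, zero_mul, zero_mul, zero_mul, sub_zero]
    rw [← h.kleinfeld_swap_pairs, kleinfeld] at e
    simpa only [fun t => (h.cycle t s c).symm, p.assoc, p.mul, Q, mul_zero, zero_mul, sub_zero,
      zero_add, h₀, eq_comm] using e
  have e₁ : s * (c * x * y) = 0 := by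
    have := P x y
    rwa [associator_apply, mul_sub, p.mul_mul, sub_zero] at this
  have e₂ : s * x * (c * y) = 0 := by
    have := h.associator_mul_of_associator_eq_zero' p.assoc x y
    rw [h.swap₁₂ c x y, neg_mul, R, associator_apply, p.mul_mul_outer h, zero_mul, zero_sub,
      neg_zero, neg_eq_zero] at this
    exact this
  have e₃ : s * (x * (c * y)) = 0 := by
    have := h.swap₂₃ s (c * y) x
    rw [p.associator_mul_mul, P, neg_zero, neg_zero, associator_apply, e₂, zero_sub,
      neg_eq_zero] at this
    exact this
  have e₄ : s * (x * c * y) = 0 := by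
    have := P x y
    rw [← neg_neg (associator c x y), ← h.swap₁₂, associator_apply, mul_neg, mul_sub, e₃, sub_zero,
      neg_eq_zero] at this
    exact this
  exact ⟨e₂, e₃, e₁, e₄⟩

theorem mul_mul_outer_outer (h : IsAlt A) (h3 : ∀ x : A, x + x + x = 0 → x = 0)
    (hN : ∀ n : A, (∀ y z, associator n y z = 0) → n = 0) (p : IsNullPair s c) (x y : A) :
    x * c * (y * s) = 0 := by
  have := h.cycle x c (y * s)
  rwa [associator_apply, p.outer', ((p.symm h).mul_mul_mul h h3 hN y x).2.2.2, zero_mul,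
    sub_zero, associator_apply, p.outer', mul_zero, sub_zero, eq_comm] at this

/-- Null pairs are stable under left multiplication of one member. -/
theorem mul_left (h : IsAlt A) (h3 : ∀ x : A, x + x + x = 0 → x = 0)
    (hN : ∀ n : A, (∀ y z, associator n y z = 0) → n = 0) (p : IsNullPair s c) (x : A) :
    IsNullPair s (x * c) where
  mul := p.outer x
  mul' := (p.symm h).mul_mul_right h x
  assoc y := by
    rw [associator_apply, p.outer, zero_mul, (p.mul_mul_mul h h3 hN x y).2.2.2, sub_zero]
  outer y := by
    have := (p.mul_associator h h3 hN y x)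
    rwa [h.cycle' c y x, associator_apply, mul_sub, p.outer, zero_sub, neg_eq_zero] at this
  outer' y := p.mul_mul_outer_outer h h3 hN x y

/-- The left multiples of an element that forms a null pair with itself do so, too. -/
theorem mul_left_self (h : IsAlt A) (h3 : ∀ x : A, x + x + x = 0 → x = 0)
    (hN : ∀ n : A, (∀ y z, associator n y z = 0) → n = 0) (p : IsNullPair c c) (x : A) :
    IsNullPair (x * c) (x * c) := by
  have e : ∀ y, x * c * (y * (x * c)) = 0 := fun y => by
    have e₁ : associator y x c = associator c y x := h.cycle _ _ _
    have e₂ : x * c * (c * (y * x)) = 0 := by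
      have := h.cycle x c (c * (y * x))
      rwa [associator_apply, associator_apply, p.mul_mul, mul_zero, zero_mul, sub_zero,
        (p.mul_mul_mul h h3 hN (y * x) x).2.2.1, sub_zero, eq_comm] at this
    have e₃ : x * c * (c * y * x) = 0 := by
      rw [h.moufang_middle, p.mul_mul, mul_zero, zero_mul]
    rw [associator_apply, associator_apply, sub_eq_iff_eq_add] at e₁
    have e₄ := p.mul_mul_outer_outer h h3 hN x (y * x)
    rw [e₁, mul_add, mul_sub, e₂, e₃, sub_zero, zero_add] at e₄
    exact e₄
  have e' := p.mul_mul_outer_outer h h3 hN x x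
  exact ⟨e', e', h.left _, e, e⟩

end IsNullPair

/-! ### Absolute zero divisors -/

/-- Simplicity for algebras whose product is that of a ring structure: the multiplication is not
zero, and there are no two-sided ideals besides `0` and `A`. -/
structure IsSimpleAlg (K A : Type*) [Field K] [NonUnitalNonAssocRing A] [Module K A] : Prop where
  exists_mul_ne_zero : ∃ x y : A, x * y ≠ 0
  eq_bot_or_eq_top : ∀ I : Submodule K A, (∀ a, ∀ b ∈ I, a * b ∈ I) → (∀ a, ∀ b ∈ I, b * a ∈ I) →
    I = ⊥ ∨ I = ⊤

section

variable {K : Type*} [Field K] [Module K A] [IsScalarTower K A A] [SMulCommClass K A A]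

/-- An element that forms a null pair with itself lies in a left ideal any two elements of which
form a null pair: every maximal subspace with the latter property is a left ideal. -/
theorem exists_leftIdeal_isNullPair (h : IsAlt A) (h3 : ∀ x : A, x + x + x = 0 → x = 0)
    (hN : ∀ n : A, (∀ y z, associator n y z = 0) → n = 0) (b : A) (hb : IsNullPair b b) :
    ∃ S : Submodule K A, b ∈ S ∧ (∀ s ∈ S, ∀ c ∈ S, IsNullPair s c) ∧
      ∀ x, ∀ c ∈ S, x * c ∈ S := by
  have span_good : ∀ (T : Submodule K A) (d : A), (∀ s ∈ T, ∀ c ∈ T, IsNullPair s c) →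
      (∀ s ∈ T, IsNullPair s d) → IsNullPair d d →
      ∀ s ∈ T ⊔ Submodule.span K {d}, ∀ c ∈ T ⊔ Submodule.span K {d}, IsNullPair s c := by
    intro T d hT hd hdd s hs c hc
    obtain ⟨s, hs', _, h₁, rfl⟩ := Submodule.mem_sup.1 hs
    obtain ⟨k, rfl⟩ := Submodule.mem_span_singleton.1 h₁
    obtain ⟨c, hc', _, h₂, rfl⟩ := Submodule.mem_sup.1 hc
    obtain ⟨l, rfl⟩ := Submodule.mem_span_singleton.1 h₂
    have h₁ : IsNullPair s (c + l • d) := (hT s hs' c hc').add ((hd s hs').smul l)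
    have h₂ : IsNullPair d (c + l • d) := ((hd c hc').symm h).add (hdd.smul l)
    exact ((h₁.symm h).add ((h₂.symm h).smul k)).symm h
  have start : ∀ s ∈ (⊥ : Submodule K A) ⊔ Submodule.span K {b}, ∀ c ∈ ⊥ ⊔ Submodule.span K {b},
      IsNullPair s c := by
    refine span_good ⊥ b ?_ ?_ hb
    · rintro s hs c hc
      rw [Submodule.mem_bot] at hs hc
      subst hs hc
      simpa using hb.smul (0 : K) |>.symm h |>.smul (0 : K)
    · rintro s hs
      rw [Submodule.mem_bot] at hs
      subst hs
      simpa using (hb.smul (0 : K)).symm h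
  obtain ⟨S, hS, hmax⟩ := zorn_le_nonempty₀
    {T : Submodule K A | ∀ s ∈ T, ∀ c ∈ T, IsNullPair s c} (by
      intro C hC hchain T hT
      refine ⟨sSup C, ?_, fun U hU => le_sSup hU⟩
      intro s hs c hc
      rw [Submodule.mem_sSup_of_directed ⟨T, hT⟩ hchain.directedOn] at hs hc
      obtain ⟨U, hU, hs⟩ := hs
      obtain ⟨V, hV, hc⟩ := hc
      rcases hchain.total hU hV with hUV | hUV
      · exact hC hV s (hUV hs) c hc
      · exact hC hU s hs c (hUV hc)) _ start
  refine ⟨S, hS (Submodule.mem_sup_right (Submodule.mem_span_singleton_self b)), hmax.prop,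
    fun x c hc => ?_⟩
  have := hmax.prop
  have hle : S ⊔ Submodule.span K {x * c} ≤ S := hmax.le_of_ge
    (span_good S (x * c) this (fun s hs => (this s hs c hc).mul_left h h3 hN x)
      ((this c hc c hc).mul_left_self h h3 hN x)) le_sup_left
  exact hle (Submodule.mem_sup_right (Submodule.mem_span_singleton_self _))

/-- In a simple algebra with zero nucleus only `0` forms a null pair with itself: if `S` is a left
ideal of mutual null pairs, then `S + S * A` is an ideal with zero multiplication. -/
theorem IsNullPair.eq_zero (h : IsAlt A) (hs : IsSimpleAlg K A)
    (h3 : ∀ x : A, x + x + x = 0 → x = 0)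
    (hN : ∀ n : A, (∀ y z, associator n y z = 0) → n = 0) {b : A} (hb : IsNullPair b b) :
    b = 0 := by
  obtain ⟨S, hbS, hS, hl⟩ := exists_leftIdeal_isNullPair (K := K) h h3 hN b hb
  set G : Set A := {z | ∃ s ∈ S, ∃ x, z = s * x} with hG
  have mem : ∀ s ∈ S, s ∈ S ⊔ Submodule.span K G := fun s hs => Submodule.mem_sup_left hs
  have mem' : ∀ s ∈ S, ∀ x, s * x ∈ S ⊔ Submodule.span K G := fun s hs x =>
    Submodule.mem_sup_right (Submodule.subset_span ⟨s, hs, x, rfl⟩)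
  have ass : ∀ s ∈ S, ∀ x a, associator x a s ∈ S := fun s hs x a =>
    Submodule.sub_mem _ (hl _ _ hs) (hl _ _ (hl _ _ hs))
  have ind : ∀ p : A → Prop, (∀ s ∈ S, p s) → (∀ s ∈ S, ∀ x, p (s * x)) →
      (∀ x y, p x → p y → p (x + y)) → (∀ (k : K) x, p x → p (k • x)) →
      ∀ z ∈ S ⊔ Submodule.span K G, p z := by
    intro p h₁ h₂ h₃ h₄ z hz
    obtain ⟨s, hs, w, hw, rfl⟩ := Submodule.mem_sup.1 hz
    refine h₃ _ _ (h₁ s hs) (Submodule.span_induction ?_ ?_ ?_ ?_ hw)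
    · rintro _ ⟨s, hs, x, rfl⟩
      exact h₂ s hs x
    · exact h₁ 0 S.zero_mem
    · exact fun x y _ _ => h₃ x y
    · exact fun k x _ => h₄ k x
  have left : ∀ a, ∀ z ∈ S ⊔ Submodule.span K G, a * z ∈ S ⊔ Submodule.span K G := by
    intro a
    refine ind _ (fun s hs => mem _ (hl a s hs)) (fun s hs x => ?_)
      (fun x y hx hy => by rw [mul_add]; exact add_mem hx hy)
      (fun k x hx => by rw [mul_smul_comm]; exact Submodule.smul_mem _ _ hx)
    have e : a * (s * x) = a * s * x - associator x a s := by
      rw [h.cycle' x a s, associator_apply, sub_sub_cancel]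
    rw [e]
    exact sub_mem (mem' _ (hl a s hs) x) (mem _ (ass s hs x a))
  have right : ∀ a, ∀ z ∈ S ⊔ Submodule.span K G, z * a ∈ S ⊔ Submodule.span K G := by
    intro a
    refine ind _ (fun s hs => mem' s hs a) (fun s hs x => ?_)
      (fun x y hx hy => by rw [add_mul]; exact add_mem hx hy)
      (fun k x hx => by rw [smul_mul_assoc]; exact Submodule.smul_mem _ _ hx)
    have e : s * x * a = s * (x * a) + associator x a s := by
      rw [← h.cycle' s x a, associator_apply, add_sub_cancel]
    rw [e]
    exact add_mem (mem' _ hs _) (mem _ (ass s hs x a))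
  rcases hs.eq_bot_or_eq_top _ left right with hbot | htop
  · have := mem b hbS
    rwa [hbot, Submodule.mem_bot] at this
  obtain ⟨x, y, hxy⟩ := hs.exists_mul_ne_zero
  refine (hxy ?_).elim
  refine ind (fun x => ∀ y, x * y = 0) (fun s hs y => ?_) (fun s hs x y => ?_) ?_ ?_ x
    (htop ▸ Submodule.mem_top) y
  · refine ind (fun y => s * y = 0) (fun c hc => (hS s hs c hc).mul)
      (fun c hc y => (hS s hs c hc).mul_mul y) (fun x y hx hy => by rw [mul_add, hx, hy, add_zero])
      (fun k x hx => by rw [mul_smul_comm, hx, smul_zero]) y (htop ▸ Submodule.mem_top)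
  · refine ind (fun y => s * x * y = 0) (fun c hc => (hS s hs c hc).mul_mul_outer h x)
      (fun c hc y => ((hS s hs c hc).mul_mul_mul h h3 hN x y).1)
      (fun x y hx hy => by rw [mul_add, hx, hy, add_zero])
      (fun k x hx => by rw [mul_smul_comm, hx, smul_zero]) y (htop ▸ Submodule.mem_top)
  · exact fun x y hx hy z => by rw [add_mul, hx, hy, add_zero]
  · exact fun k x hx z => by rw [smul_mul_assoc, hx, smul_zero]

/-- A simple alternative algebra with zero nucleus has no absolute zero divisors. -/
theorem eq_zero_of_mul_mul_self (h : IsAlt A) (hs : IsSimpleAlg K A)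
    (h3 : ∀ x : A, x + x + x = 0 → x = 0)
    (hN : ∀ n : A, (∀ y z, associator n y z = 0) → n = 0) {b : A} (hb : ∀ x, b * (x * b) = 0) :
    b = 0 := by
  -- If `b * b = 0`, then `b` forms a null pair with itself; in general `b * b` does.
  have sq : b * b = 0 → b = 0 := fun e =>
    IsNullPair.eq_zero (K := K) h hs h3 hN ⟨e, e, h.left b, hb, hb⟩
  refine sq ?_
  have e : b * b * (b * b) = 0 := by rw [h.left_alternative, hb, mul_zero]
  refine IsNullPair.eq_zero (K := K) h hs h3 hN ⟨e, e, h.left _, ?_, ?_⟩ <;>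
  · intro x
    rw [h.left_alternative, ← h.right_alternative x b, hb, mul_zero]

end

/-! ### The nucleus of a simple algebra -/

/-- Extraction of the coefficient of `t` in `(U + t V) ^ n` for `n ≤ 4`, from `t = ±1, ±2`. -/
theorem add_pow_linear_part {R : Type*} [Ring R] (U V : R) {n : ℕ} (hn : n ≤ 4) :
    8 • ((U + V) ^ n - (U - V) ^ n) - ((U + 2 • V) ^ n - (U - 2 • V) ^ n) =
      12 • ∑ i ∈ Finset.range n, U ^ i * V * U ^ (n - 1 - i) := by
  interval_cases n <;> 
    simp only [Finset.sum_range_succ, Finset.sum_range_zero, Nat.reduceSub, Nat.sub_zero, pow_zero,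
      mul_one] <;>
    noncomm_ring

section

local notation "L" => AddMonoid.End.mulLeft (R := A)

theorem IsAlt.mulLeft_moufang (h : IsAlt A) (x y : A) : L (x * y * x) = L x * (L y * L x) :=
  AddMonoidHom.ext fun z => h.moufang_left x y z

/-- Left multiplication by the word `a y a y ⋯ a` is the corresponding word in the left
multiplications by `a` and `y`. -/
theorem IsAlt.mulLeft_pow (h : IsAlt A) (a y : A) :
    ∀ k : ℕ, L (((L a * L y) ^ k) a) = (L a * L y) ^ k * L a
  | 0 => by simp
  | 1 => by
    have : (L a * L y) a = a * y * a := (h.flexible_mul a y).symm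
    rw [pow_one, this, h.mulLeft_moufang, mul_assoc]
  | k + 2 => by
    have ih := h.mulLeft_pow a y k
    set e := ((L a * L y) ^ k) a
    -- The word with `k + 2` letters `y` is `a (y e y) a`, by the left Moufang identity.
    have : ((L a * L y) ^ (k + 2)) a = a * (y * e * y) * a := by
      have e₁ : ((L a * L y) ^ (k + 2)) a = a * (y * (((L a * L y) ^ k * L a) (y * a))) := by
        rw [show k + 2 = 1 + k + 1 by ring, pow_succ, pow_add, pow_one]
        rfl
      rw [e₁, ← ih, h.flexible_mul a, h.moufang_left]
      rfl
    rw [this, h.mulLeft_moufang, h.mulLeft_moufang, ih, show k + 2 = 1 + k + 1 by ring, pow_succ,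
      pow_add, pow_one]
    simp only [mul_assoc]

/-- If `a * a = 0`, then multiplying `a` repeatedly by `[a, y]` produces the words
`a y a y ⋯ a`. -/
theorem IsAlt.mulLeft_commutator_pow (h : IsAlt A) {a : A} (ha : a * a = 0) (y : A) (k : ℕ) :
    (L (a * y - y * a) ^ k) a = ((L a * L y) ^ k) a ∧ a * ((L a * L y) ^ k) a = 0 ∧
      associator a (((L a * L y) ^ k) a) y = 0 := by
  induction k with
  | zero => exact ⟨rfl, ha, h.left a y⟩
  | succ k ih =>
    obtain ⟨e₁, e₂, e₃⟩ := ih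
    rw [pow_succ', pow_succ']
    change (a * y - y * a) * ((L (a * y - y * a) ^ k) a) = a * (y * ((L a * L y) ^ k) a) ∧
      a * (a * (y * ((L a * L y) ^ k) a)) = 0 ∧ associator a (a * (y * ((L a * L y) ^ k) a)) y = 0
    rw [e₁]
    set e := ((L a * L y) ^ k) a
    have e₄ : associator a y e = 0 := by rw [h.swap₂₃ a e y, e₃, neg_zero]
    have e₅ : associator y a e = 0 := by rw [h.swap₁₂, e₄, neg_zero]
    have e₆ : associator (y * e) y a = 0 := by
      rw [h.associator_mul_of_associator_eq_zero' (h.left y), ← h.cycle' a e y, e₃, zero_mul]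
    have e₇ : associator (a * (y * e)) a y = 0 := by
      rw [h.associator_mul_of_associator_eq_zero' (h.left a), h.swap₂₃ (y * e) y a, e₆, neg_zero,
        zero_mul]
    refine ⟨?_, ?_, ?_⟩
    · rw [associator_apply, sub_eq_zero] at e₄ e₅
      rw [sub_mul, e₄, e₅, e₂, mul_zero, sub_zero]
    · rw [← h.left_alternative, ha, zero_mul]
    · rw [h.swap₁₂ (a * (y * e)) a, e₇, neg_zero]

variable {K : Type*} [Field K] [CharZero K] [Module K A] [IsScalarTower K A A]
  [SMulCommClass K A A]

/-- A simple alternative algebra over a field of characteristic zero has a nonzero nucleus. -/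
theorem IsSimpleAlg.exists_nuclear (hs : IsSimpleAlg K A) (h : IsAlt A) :
    ∃ n : A, n ≠ 0 ∧ ∀ y z, associator n y z = 0 := by
  have tors : ∀ m : ℕ, m ≠ 0 → ∀ x : A, m • x = 0 → x = 0 := fun m hm x hx => by
    rw [← Nat.cast_smul_eq_nsmul K] at hx
    exact (smul_eq_zero.1 hx).resolve_left (Nat.cast_ne_zero.2 hm)
  have h3 : ∀ x : A, x + x + x = 0 → x = 0 := fun x hx =>
    tors 3 three_ne_zero x (by rw [← hx]; abel)
  by_contra! hcon
  have hN : ∀ n : A, (∀ y z, associator n y z = 0) → n = 0 := fun n hn => by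
    by_contra hn0
    obtain ⟨y, z, hyz⟩ := hcon n hn0
    exact hyz (hn y z)
  have inj : ∀ u : A, L u = 0 → u = 0 := fun u hu => by
    have hu' : ∀ x, u * x = 0 := fun x => DFunLike.congr_fun hu x
    exact hN u fun y z => by rw [associator_apply, hu', hu', zero_mul, sub_zero]
  have pow_four : ∀ x y : A, (x * y - y * x) * (x * y - y * x) *
      ((x * y - y * x) * (x * y - y * x)) = 0 := fun x y =>
    hN _ fun z t => h.commutator_pow_four_nuclear x y z t
  -- The nilpotency index of the operators `L a * L y` can be lowered one by one.
  have down : ∀ a : A, ∀ k ≤ 3, (∀ y, (L a * L y) ^ (k + 1) * L a = 0) →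
      ∀ y, (L a * L y) ^ k * L a = 0 := by
    intro a k hk hQ y
    rw [← h.mulLeft_pow]
    suffices ((L a * L y) ^ k) a = 0 by rw [this, map_zero]
    refine eq_zero_of_mul_mul_self (K := K) h hs h3 hN fun z => ?_
    rw [← h.flexible_mul]
    apply inj
    rw [h.mulLeft_moufang, h.mulLeft_pow]
    -- Linearize the hypothesis in `y`, and multiply by `(L a * L y) ^ k` to isolate one term.
    have lin := congrArg (· * L a)
      (add_pow_linear_part (L a * L y) (L a * L z) (n := k + 1) (by omega))
    have e₁ : L a * L y + L a * L z = L a * L (y + z) := by rw [map_add, mul_add]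
    have e₂ : L a * L y - L a * L z = L a * L (y - z) := by rw [map_sub, mul_sub]
    have e₃ : L a * L y + 2 • (L a * L z) = L a * L (y + 2 • z) := by
      rw [map_add, mul_add, map_nsmul, mul_smul_comm]
    have e₄ : L a * L y - 2 • (L a * L z) = L a * L (y - 2 • z) := by
      rw [map_sub, mul_sub, map_nsmul, mul_smul_comm]
    simp only [e₁, e₂, e₃, e₄] at lin
    simp only [sub_mul, smul_mul_assoc, hQ, sub_zero, nsmul_zero] at lin
    have lin' : (∑ i ∈ Finset.range (k + 1), (L a * L y) ^ i * (L a * L z) *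
        (L a * L y) ^ (k + 1 - 1 - i)) * L a = 0 := by
      refine AddMonoidHom.ext fun x => tors 12 (by norm_num) _ ?_
      exact (DFunLike.congr_fun lin x).symm
    have lin'' := congrArg ((L a * L y) ^ k * ·) lin'
    simp only [Finset.sum_range_succ', add_mul, mul_add, mul_zero] at lin''
    rw [Finset.sum_mul, Finset.mul_sum, Finset.sum_eq_zero, zero_add] at lin''
    · rw [← lin'']
      simp [mul_assoc]
    · intro i _
      have : (L a * L y) ^ k * ((L a * L y) ^ (i + 1) * (L a * L z) *
          (L a * L y) ^ (k + 1 - 1 - (i + 1)) * L a) = (L a * L y) ^ i *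
          ((L a * L y) ^ (k + 1) * L a) * L z * (L a * L y) ^ (k + 1 - 1 - (i + 1)) * L a := by
        simp only [← mul_assoc]
        rw [← pow_add, ← pow_add, show k + (i + 1) = i + (k + 1) by ring]
      rw [this, hQ]
      simp
  -- Hence there are no nilpotent elements, so the commutators vanish, and with them the associators.
  have sq : ∀ a : A, a * a = 0 → a = 0 := fun a ha => by
    have h₄ : ∀ y, (L a * L y) ^ 4 * L a = 0 := fun y => by
      rw [← h.mulLeft_pow, ← (h.mulLeft_commutator_pow ha y 4).1]
      have : (L (a * y - y * a) ^ 4) a = 0 := by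
        set v := a * y - y * a with hv
        change v * (v * (v * (v * a))) = 0
        rw [← h.left_alternative, ← h.left_alternative v a, ← h.left_alternative (v * v),
          pow_four, zero_mul]
      rw [this, map_zero]
    have h₀ := down a 0 (by norm_num) (down a 1 (by norm_num) (down a 2 (by norm_num)
      (down a 3 le_rfl h₄))) 0
    rw [pow_zero, one_mul] at h₀
    exact inj a h₀
  have comm : ∀ x y : A, x * y = y * x := fun x y => sub_eq_zero.1 (sq _ (sq _ (pow_four x y)))
  have zero : ∀ x : A, x = 0 := fun x => hN x fun y z => by
    refine h3 _ ?_
    rw [← h.three_associator x y z, comm (x * y) z, comm y z, comm x z]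
    simp
  obtain ⟨x, y, hxy⟩ := hs.exists_mul_ne_zero
  exact hxy (zero _)

end

/-! ### Twisting by an automorphism -/

variable {K : Type*} [Field K] [Module K A]
  [IsScalarTower K A A] [SMulCommClass K A A]

/-- A subspace that contains a nonzero nuclear element `m` and all elements `x * m`, `m * x` and
`x * m * y` is the whole algebra, since these elements span the ideal generated by `m`. -/
theorem IsSimpleAlg.eq_top_of_nuclear (hs : IsSimpleAlg K A) (h : IsAlt A) {m : A} (hm : m ≠ 0)
    (hnuc : ∀ y z, associator m y z = 0) (J : Submodule K A) (h₀ : m ∈ J) (h₁ : ∀ x, x * m ∈ J)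
    (h₂ : ∀ x, m * x ∈ J) (h₃ : ∀ x y, x * m * y ∈ J) : J = ⊤ := by
  set G : Set A := {w | w = m ∨ (∃ x, w = x * m) ∨ (∃ x, w = m * x) ∨ ∃ x y, w = x * m * y}
  have g₀ : m ∈ Submodule.span K G := Submodule.subset_span (Or.inl rfl)
  have g₁ : ∀ x, x * m ∈ Submodule.span K G := fun x =>
    Submodule.subset_span (Or.inr (Or.inl ⟨x, rfl⟩))
  have g₂ : ∀ x, m * x ∈ Submodule.span K G := fun x =>
    Submodule.subset_span (Or.inr (Or.inr (Or.inl ⟨x, rfl⟩)))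
  have g₃ : ∀ x y, x * m * y ∈ Submodule.span K G := fun x y =>
    Submodule.subset_span (Or.inr (Or.inr (Or.inr ⟨x, y, rfl⟩)))
  have nuc₁ : ∀ x y, m * x * y = m * (x * y) := fun x y => sub_eq_zero.1 (hnuc x y)
  have nuc₂ : ∀ x y, x * m * y = x * (m * y) := fun x y => sub_eq_zero.1 (by
    rw [← associator_apply, h.swap₁₂, hnuc, neg_zero])
  have nuc₃ : ∀ x y, x * y * m = x * (y * m) := fun x y => sub_eq_zero.1 (by
    rw [← associator_apply, h.cycle m x y, hnuc])
  have ass : ∀ x y z, associator (x * m) y z = m * associator x y z := fun x y z =>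
    h.associator_mul_of_associator_eq_zero (hnuc y) x z
  have left : ∀ a, ∀ w ∈ Submodule.span K G, a * w ∈ Submodule.span K G := by
    intro a w hw
    refine Submodule.span_induction ?_ (by rw [mul_zero]; exact Submodule.zero_mem _)
      (fun x y _ _ hx hy => by rw [mul_add]; exact add_mem hx hy)
      (fun k x _ hx => by rw [mul_smul_comm]; exact Submodule.smul_mem _ _ hx) hw
    rintro w (rfl | ⟨x, rfl⟩ | ⟨x, rfl⟩ | ⟨x, y, rfl⟩)
    · exact g₁ a
    · rw [← nuc₃]; exact g₁ _
    · rw [← nuc₂]; exact g₃ _ _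
    · have e := h.swap₁₂ a (x * m) y
      rw [ass, associator_apply a, neg_sub, ← nuc₃] at e
      rw [← eq_sub_iff_add_eq.1 e]
      exact add_mem (g₂ _) (g₃ _ _)
  have right : ∀ a, ∀ w ∈ Submodule.span K G, w * a ∈ Submodule.span K G := by
    intro a w hw
    refine Submodule.span_induction ?_ (by rw [zero_mul]; exact Submodule.zero_mem _)
      (fun x y _ _ hx hy => by rw [add_mul]; exact add_mem hx hy)
      (fun k x _ hx => by rw [smul_mul_assoc]; exact Submodule.smul_mem _ _ hx) hw
    rintro w (rfl | ⟨x, rfl⟩ | ⟨x, rfl⟩ | ⟨x, y, rfl⟩)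
    · exact g₂ a
    · exact g₃ _ _
    · rw [nuc₁]; exact g₂ _
    · have e := ass x y a
      rw [associator_apply (x * m), sub_eq_iff_eq_add] at e
      rw [e]
      exact add_mem (g₂ _) (g₃ _ _)
  rcases hs.eq_bot_or_eq_top _ left right with hbot | htop
  · rw [hbot] at g₀
    exact absurd ((Submodule.mem_bot K).1 g₀) hm
  · rw [eq_top_iff, ← htop, Submodule.span_le]
    rintro w (rfl | ⟨x, rfl⟩ | ⟨x, rfl⟩ | ⟨x, y, rfl⟩)
    exacts [h₀, h₁ x, h₂ x, h₃ x y]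

/-- A simple alternative algebra has no proper nonzero Hom-ideals for the twist of its product by
an automorphism `α`. -/
theorem IsSimpleAlg.eq_bot_or_eq_top_of_twist [CharZero K] (hs : IsSimpleAlg K A) (h : IsAlt A)
    (α : A →ₗ[K] A) (hα : Function.Bijective α) (hmul : ∀ x y, α (x * y) = α x * α y)
    (J : Submodule K A) (hJ : ∀ b ∈ J, α b ∈ J) (hl : ∀ a, ∀ b ∈ J, α (a * b) ∈ J)
    (hr : ∀ a, ∀ b ∈ J, α (b * a) ∈ J) : J = ⊥ ∨ J = ⊤ := by
  by_cases hbot : J = ⊥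
  · exact Or.inl hbot
  right
  -- The union of the preimages of `J` under the powers of `α` is an ideal for the untwisted
  -- product, so every element is moved into `J` by some power of `α`.
  have hmulk : ∀ (k : ℕ) x y, (α ^ k) (x * y) = (α ^ k) x * (α ^ k) y := by
    intro k
    induction k with
    | zero => intro x y; rfl
    | succ k ih => intro x y; simp only [pow_succ', Module.End.mul_apply, ih, hmul]
  have mono : Monotone fun k : ℕ => J.comap (α ^ k) := monotone_nat_of_le_succ fun k x hx => by
    rw [Submodule.mem_comap, pow_succ', Module.End.mul_apply]
    exact hJ _ hx
  have mem : ∀ x, x ∈ (⨆ k : ℕ, J.comap (α ^ k)) ↔ ∃ k : ℕ, (α ^ k) x ∈ J := fun x =>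
    Submodule.mem_iSup_of_directed _ mono.directed_le
  have htop : (⨆ k : ℕ, J.comap (α ^ k)) = ⊤ := by
    refine (hs.eq_bot_or_eq_top _ ?_ ?_).resolve_left fun hb => hbot ?_
    · intro a b hb
      obtain ⟨k, hk⟩ := (mem b).1 hb
      refine (mem _).2 ⟨k + 1, ?_⟩
      rw [pow_succ', Module.End.mul_apply, hmulk]
      exact hl _ _ hk
    · intro a b hb
      obtain ⟨k, hk⟩ := (mem b).1 hb
      refine (mem _).2 ⟨k + 1, ?_⟩
      rw [pow_succ', Module.End.mul_apply, hmulk]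
      exact hr _ _ hk
    · rw [eq_bot_iff, ← hb]
      exact fun x hx => (mem x).2 ⟨0, hx⟩
  have nuc : ∀ n, (∀ y z, associator n y z = 0) → ∀ y z, associator (α n) y z = 0 := by
    intro n hn y z
    obtain ⟨y, rfl⟩ := hα.2 y
    obtain ⟨z, rfl⟩ := hα.2 z
    rw [associator_apply, ← hmul, ← hmul, ← hmul, ← hmul, ← map_sub, ← associator_apply, hn,
      map_zero]
  -- Move a nonzero nuclear element into `J`, and on to its second image under `α`.
  obtain ⟨n₀, hn₀, hnuc₀⟩ := hs.exists_nuclear h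
  obtain ⟨k, hk⟩ := (mem n₀).1 (htop ▸ Submodule.mem_top)
  obtain ⟨n, hn, hnuc, hnJ⟩ : ∃ n, n ≠ 0 ∧ (∀ y z, associator n y z = 0) ∧ n ∈ J := by
    refine ⟨_, ?_, ?_, hk⟩
    · clear hk
      induction k with
      | zero => exact hn₀
      | succ k ih =>
        rw [pow_succ', Module.End.mul_apply]
        exact (map_ne_zero_iff α hα.1).2 ih
    · clear hk
      induction k with
      | zero => exact hnuc₀
      | succ k ih =>
        rw [pow_succ', Module.End.mul_apply]
        exact nuc _ ih
  refine hs.eq_top_of_nuclear h (m := α (α n)) ?_ (nuc _ (nuc _ hnuc)) J (hJ _ (hJ _ hnJ)) ?_ ?_ ?_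
  · rwa [map_ne_zero_iff α hα.1, map_ne_zero_iff α hα.1]
  · intro x
    obtain ⟨x, rfl⟩ := hα.2 x
    rw [← hmul]
    exact hl _ _ (hJ _ hnJ)
  · intro x
    obtain ⟨x, rfl⟩ := hα.2 x
    rw [← hmul]
    exact hr _ _ (hJ _ hnJ)
  · intro x y
    obtain ⟨x, rfl⟩ := hα.2 x
    obtain ⟨x, rfl⟩ := hα.2 x
    obtain ⟨y, rfl⟩ := hα.2 y
    rw [← hmul, ← hmul, ← hmul]
    exact hr _ _ (hl _ _ hnJ)

end Alternative

/-! ### Simple Hom-ideals -/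

namespace HomAlg

variable {K : Type*} [Field K] {A : Type*} [AddCommGroup A] [Module K A]

/-- The ring structure given by a bilinear product. -/
abbrev toRing (μ : A →ₗ[K] A →ₗ[K] A) : NonUnitalNonAssocRing A :=
  { ‹AddCommGroup A› with
    mul := fun x y => μ x y
    left_distrib := fun x y z => (μ x).map_add y z
    right_distrib := fun x y z => μ.map_add₂ x y z
    zero_mul := fun x => μ.map_zero₂ x
    mul_zero := fun x => (μ x).map_zero }

theorem derived_ne_bot_iff {μ : A →ₗ[K] A →ₗ[K] A} : derived μ ≠ ⊥ ↔ ∃ x y, μ x y ≠ 0 := by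
  rw [Ne, derived, Submodule.span_eq_bot]
  simp only [Set.mem_ofPred_eq, forall_exists_index]
  push Not
  exact ⟨fun ⟨_, x, y, e, h⟩ => ⟨x, y, e ▸ h⟩, fun ⟨x, y, h⟩ => ⟨_, x, y, rfl, h⟩⟩

theorem IsAlternative.isHomAlternative {μ : A →ₗ[K] A →ₗ[K] A} (h : IsAlternative μ)
    {α : A →ₗ[K] A} (hmul : ∀ x y, α (μ x y) = μ (α x) (α y)) :
    IsHomAlternative (μ.compr₂ α) α where
  multiplicative x y := by simp only [LinearMap.compr₂_apply, hmul]
  left x y := by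
    simp only [homAssociator, LinearMap.compr₂_apply, ← hmul, h.left, sub_self]
  right x y := by
    simp only [homAssociator, LinearMap.compr₂_apply, ← hmul, h.right, sub_self]

theorem IsSimpleAlternative.isSimpleHomAlternative [CharZero K] {μ : A →ₗ[K] A →ₗ[K] A}
    (h : IsSimpleAlternative μ) {α : A →ₗ[K] A} (hα : Function.Bijective α)
    (hmul : ∀ x y, α (μ x y) = μ (α x) (α y)) : IsSimpleHomAlternative (μ.compr₂ α) α := by
  obtain ⟨x, y, hxy⟩ := derived_ne_bot_iff.1 h.derived_ne_bot
  have hαxy := (map_ne_zero_iff α hα.1).2 hxy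
  refine ⟨h.alternative.isHomAlternative hmul, fun h₀ => hαxy (by rw [h₀]; rfl),
    derived_ne_bot_iff.2 ⟨x, y, hαxy⟩, fun J hJ => ?_⟩
  let _ := toRing μ
  have : IsScalarTower K A A := ⟨fun k x y => μ.map_smul₂ k x y⟩
  have : SMulCommClass K A A := ⟨fun k x y => ((μ x).map_smul k y).symm⟩
  have hA : Alternative.IsAlt A :=
    ⟨fun x y => sub_eq_zero.2 (h.alternative.left x y),
      fun x y => sub_eq_zero.2 (h.alternative.right x y)⟩
  have hS : Alternative.IsSimpleAlg K A :=
    ⟨⟨x, y, hxy⟩, fun I hl hr => h.eq_bot_or_eq_top I ⟨hl, hr⟩⟩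
  exact hS.eq_bot_or_eq_top_of_twist hA α hα hmul J hJ.twist_mem hJ.mul_mem_left hJ.mul_mem_right

/-- An ideal stable under `α` that is simple for `μ` is simple for the twisted product. -/
theorem IsSimpleIdeal.isSimpleHomIdeal [CharZero K] {μ : A →ₗ[K] A →ₗ[K] A} {I : Submodule K A}
    (h : IsSimpleIdeal μ I) {α : A →ₗ[K] A} (hα : Function.Injective α)
    (hmul : ∀ x y, α (μ x y) = μ (α x) (α y)) (hI : I.map α = I) :
    IsSimpleHomIdeal (μ.compr₂ α) α I := by
  obtain ⟨hid, hs⟩ := h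
  have hαI : ∀ b ∈ I, α b ∈ I := fun b hb => by
    rw [← hI]
    exact Submodule.mem_map_of_mem hb
  refine ⟨⟨fun a b hb => hαI _ (hid.mul_mem_left a b hb),
    fun a b hb => hαI _ (hid.mul_mem_right a b hb), hαI⟩, ?_⟩
  refine hs.isSimpleHomAlternative (α := α.restrict hαI) ⟨fun x y hxy => ?_, fun y => ?_⟩
    fun x y => Subtype.ext (hmul x y)
  · exact Subtype.ext (hα (congrArg Subtype.val hxy))
  · obtain ⟨x, hx, hxy⟩ : (y : A) ∈ I.map α := by rw [hI]; exact y.2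
    exact ⟨⟨x, hx⟩, Subtype.ext hxy⟩

theorem IsSimpleHomIdeal.exists_mul_ne_zero {μ : A →ₗ[K] A →ₗ[K] A} {α : A →ₗ[K] A}
    {I : Submodule K A} (h : IsSimpleHomIdeal μ α I) : ∃ x ∈ I, ∃ y ∈ I, μ x y ≠ 0 := by
  obtain ⟨hid, hs⟩ := h
  obtain ⟨x, y, hxy⟩ := derived_ne_bot_iff.1 hs.derived_ne_bot
  exact ⟨x, x.2, y, y.2, fun e => hxy (Subtype.ext e)⟩

theorem IsSimpleHomIdeal.ne_bot {μ : A →ₗ[K] A →ₗ[K] A} {α : A →ₗ[K] A}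
    {I : Submodule K A} (h : IsSimpleHomIdeal μ α I) : I ≠ ⊥ := by
  rintro rfl
  obtain ⟨x, hx, y, -, hxy⟩ := h.exists_mul_ne_zero
  rw [(Submodule.mem_bot K).1 hx, LinearMap.map_zero₂] at hxy
  exact hxy rfl

/-- A subspace of a simple Hom-ideal `I` which is stable under `α` and under multiplication by `I`
is trivial. -/
theorem IsSimpleHomIdeal.eq_bot_or_eq {μ : A →ₗ[K] A →ₗ[K] A} {α : A →ₗ[K] A}
    {I J : Submodule K A} (h : IsSimpleHomIdeal μ α I) (hJI : J ≤ I)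
    (hl : ∀ a ∈ I, ∀ b ∈ J, μ a b ∈ J) (hr : ∀ a ∈ I, ∀ b ∈ J, μ b a ∈ J)
    (hα : ∀ b ∈ J, α b ∈ J) : J = ⊥ ∨ J = I := by
  obtain ⟨hid, hs⟩ := h
  have := hs.eq_bot_or_eq_top (J.comap I.subtype)
    ⟨fun a b hb => hl a a.2 b hb, fun a b hb => hr a a.2 b hb, fun b hb => hα b hb⟩
  rcases this with hbot | htop
  · left
    rw [eq_bot_iff]
    intro x hx
    have : (⟨x, hJI hx⟩ : I) ∈ J.comap I.subtype := hx
    rw [hbot, Submodule.mem_bot] at this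
    exact (Submodule.mem_bot K).2 (congrArg Subtype.val this)
  · exact Or.inr (hJI.antisymm (Submodule.comap_subtype_eq_top.1 htop))

theorem IsSimpleHomIdeal.eq_or_disjoint {μ : A →ₗ[K] A →ₗ[K] A} {α : A →ₗ[K] A}
    {I J : Submodule K A} (hI : IsSimpleHomIdeal μ α I) (hJ : IsSimpleHomIdeal μ α J) :
    I = J ∨ I ⊓ J = ⊥ := by
  obtain ⟨h₁, -⟩ := id hI
  obtain ⟨h₂, -⟩ := id hJ
  have hl : ∀ a, ∀ b ∈ I ⊓ J, μ a b ∈ I ⊓ J := fun a b hb =>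
    ⟨h₁.mul_mem_left a b hb.1, h₂.mul_mem_left a b hb.2⟩
  have hr : ∀ a, ∀ b ∈ I ⊓ J, μ b a ∈ I ⊓ J := fun a b hb =>
    ⟨h₁.mul_mem_right a b hb.1, h₂.mul_mem_right a b hb.2⟩
  have hα : ∀ b ∈ I ⊓ J, α b ∈ I ⊓ J := fun b hb => ⟨h₁.twist_mem b hb.1, h₂.twist_mem b hb.2⟩
  rcases hI.eq_bot_or_eq inf_le_left (fun a _ => hl a) (fun a _ => hr a) hα with e | e
  · exact Or.inr e
  rcases hJ.eq_bot_or_eq inf_le_right (fun a _ => hl a) (fun a _ => hr a) hα with e' | e'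
  · exact Or.inr e'
  · exact Or.inl (e.symm.trans e')

/-- Every simple Hom-ideal occurs in every decomposition into simple Hom-ideals: it cannot
annihilate all the summands. -/
theorem IsSimpleHomIdealDecomposition.exists_eq {μ : A →ₗ[K] A →ₗ[K] A} {α : A →ₗ[K] A} {p : ℕ}
    {S : Fin p → Submodule K A} (hS : IsSimpleHomIdealDecomposition μ α S) {I : Submodule K A}
    (hI : IsSimpleHomIdeal μ α I) : ∃ i, I = S i := by
  by_contra! hne
  obtain ⟨x, hx, y, -, hxy⟩ := hI.exists_mul_ne_zero
  have htop : (⊤ : Submodule K A) ≤ LinearMap.ker (μ x) := by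
    rw [← hS.isInternal.submodule_iSup_eq_top]
    refine iSup_le fun i s hs => ?_
    have hinf := (hI.eq_or_disjoint (hS.simple i)).resolve_left (hne i)
    obtain ⟨h₁, -⟩ := id hI
    obtain ⟨h₂, -⟩ := hS.simple i
    have : μ x s ∈ I ⊓ S i := ⟨h₁.mul_mem_right s x hx, h₂.mul_mem_left x s hs⟩
    rwa [hinf] at this
  exact hxy (htop Submodule.mem_top)

theorem IsSimpleHomIdealDecomposition.injective {μ : A →ₗ[K] A →ₗ[K] A} {α : A →ₗ[K] A} {p : ℕ}
    {S : Fin p → Submodule K A} (hS : IsSimpleHomIdealDecomposition μ α S) :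
    Function.Injective S :=
  hS.isInternal.submodule_iSupIndep.injective fun i => (hS.simple i).ne_bot

theorem IsSimpleHomIdealDecomposition.unique {μ : A →ₗ[K] A →ₗ[K] A} {α : A →ₗ[K] A} {s t : ℕ}
    {S : Fin s → Submodule K A} {T : Fin t → Submodule K A}
    (hS : IsSimpleHomIdealDecomposition μ α S) (hT : IsSimpleHomIdealDecomposition μ α T) :
    ∃ e : Fin t ≃ Fin s, ∀ j, T j = S (e j) := by
  choose f hf using fun j => hS.exists_eq (hT.simple j)
  refine ⟨Equiv.ofBijective f ⟨fun j k hjk => hT.injective ?_, fun i => ?_⟩, hf⟩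
  · rw [hf, hf, hjk]
  · obtain ⟨j, hj⟩ := hT.exists_eq (hS.simple i)
    exact ⟨j, hS.injective ((hf j).symm.trans hj.symm)⟩

/-! ### Untwisting a semisimple Hom-algebra -/

variable {μ μ' : A →ₗ[K] A →ₗ[K] A} {α : A →ₗ[K] A}

/-- The twisting map is injective on a simple Hom-ideal, as its kernel there is a Hom-ideal. -/
theorem IsSimpleHomIdeal.inf_ker_eq_bot {I : Submodule K A}
    (hmul : ∀ x y, α (μ x y) = μ (α x) (α y)) (hI : IsSimpleHomIdeal μ α I) :
    I ⊓ LinearMap.ker α = ⊥ := by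
  obtain ⟨hid, hs⟩ := id hI
  refine (hI.eq_bot_or_eq inf_le_left (fun a _ b hb => ⟨hid.mul_mem_left a b hb.1, ?_⟩)
    (fun a _ b hb => ⟨hid.mul_mem_right a b hb.1, ?_⟩) fun b hb => ⟨hid.twist_mem b hb.1, ?_⟩
    ).resolve_right fun h => hs.twist_ne_zero ?_
  · exact LinearMap.mem_ker.2 (by rw [hmul, LinearMap.mem_ker.1 hb.2, map_zero])
  · exact LinearMap.mem_ker.2 (by rw [hmul, LinearMap.mem_ker.1 hb.2, LinearMap.map_zero₂])
  · exact LinearMap.mem_ker.2 (by rw [LinearMap.mem_ker.1 hb.2, map_zero])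
  · exact LinearMap.ext fun x => Subtype.ext (inf_eq_left.1 h x.2)

theorem IsSimpleHomIdeal.map_eq [FiniteDimensional K A] {I : Submodule K A}
    (hmul : ∀ x y, α (μ x y) = μ (α x) (α y)) (hI : IsSimpleHomIdeal μ α I) :
    I.map α = I := by
  have hinf := hI.inf_ker_eq_bot hmul
  obtain ⟨hid, -⟩ := hI
  have hinj : Function.Injective (α.restrict hid.twist_mem) := by
    rw [← LinearMap.ker_eq_bot, eq_bot_iff]
    intro x hx
    have : (x : A) ∈ I ⊓ LinearMap.ker α := ⟨x.2, congrArg Subtype.val (LinearMap.mem_ker.1 hx)⟩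
    rw [hinf] at this
    exact Subtype.ext ((Submodule.mem_bot K).1 this)
  refine le_antisymm (Submodule.map_le_iff_le_comap.2 hid.twist_mem) fun y hy => ?_
  obtain ⟨x, hx⟩ := LinearMap.injective_iff_surjective.1 hinj ⟨y, hy⟩
  exact ⟨x, x.2, congrArg Subtype.val hx⟩

theorem IsSemisimpleHomAlternative.bijective [FiniteDimensional K A]
    (h : IsSemisimpleHomAlternative μ α) : Function.Bijective α := by
  obtain ⟨p, S, hS⟩ := h.exists_decomposition
  have hsurj : Function.Surjective α := by
    rw [← LinearMap.range_eq_top, eq_top_iff, ← hS.isInternal.submodule_iSup_eq_top]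
    refine iSup_le fun i => ?_
    rw [← (hS.simple i).map_eq h.homAlternative.multiplicative]
    exact LinearMap.map_le_range
  exact ⟨LinearMap.injective_iff_surjective.2 hsurj, hsurj⟩

/-- Undoing the twist of a Hom-alternative algebra by an injective map `α`. -/
theorem IsHomAlternative.untwist (h : IsHomAlternative μ α) (hα : Function.Injective α)
    (hμ : ∀ x y, μ x y = α (μ' x y)) :
    (∀ x y, α (μ' x y) = μ' (α x) (α y)) ∧ IsAlternative μ' := by
  have hmul : ∀ x y, α (μ' x y) = μ' (α x) (α y) := fun x y => hα (by
    rw [← hμ x y, h.multiplicative, hμ])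
  refine ⟨hmul, fun x y => ?_, fun x y => ?_⟩
  · have := h.left x y
    simp only [homAssociator, hμ, ← hmul, ← map_sub] at this
    exact sub_eq_zero.1 ((map_eq_zero_iff α hα).1 ((map_eq_zero_iff α hα).1 this))
  · have := h.right x y
    simp only [homAssociator, hμ, ← hmul, ← map_sub] at this
    exact sub_eq_zero.1 ((map_eq_zero_iff α hα).1 ((map_eq_zero_iff α hα).1 this))

/-! ### Minimal ideals -/

/-- Minimal nonzero two-sided ideals. -/
structure IsMinimalIdeal (μ : A →ₗ[K] A →ₗ[K] A) (M : Submodule K A) : Prop where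
  isIdeal : IsIdeal μ M
  ne_bot : M ≠ ⊥
  eq_bot_or_eq : ∀ J, IsIdeal μ J → J ≤ M → J = ⊥ ∨ J = M

theorem IsIdeal.inf {I J : Submodule K A} (hI : IsIdeal μ I) (hJ : IsIdeal μ J) :
    IsIdeal μ (I ⊓ J) :=
  ⟨fun a b hb => ⟨hI.mul_mem_left a b hb.1, hJ.mul_mem_left a b hb.2⟩,
    fun a b hb => ⟨hI.mul_mem_right a b hb.1, hJ.mul_mem_right a b hb.2⟩⟩

theorem IsIdeal.exists_isMinimalIdeal [FiniteDimensional K A] {I : Submodule K A}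
    (hI : IsIdeal μ I) (hne : I ≠ ⊥) : ∃ M ≤ I, IsMinimalIdeal μ M := by
  obtain ⟨M, ⟨hM, hMne, hMI⟩, hmin⟩ := (wellFounded_lt (α := Submodule K A)).has_min
    {M | IsIdeal μ M ∧ M ≠ ⊥ ∧ M ≤ I} ⟨I, hI, hne, le_rfl⟩
  refine ⟨M, hMI, hM, hMne, fun J hJ hJM => ?_⟩
  by_cases hbot : J = ⊥
  · exact Or.inl hbot
  · exact Or.inr (hJM.eq_of_not_lt (hmin J ⟨hJ, hbot, hJM.trans hMI⟩))

/-- Distinct minimal ideals annihilate each other. -/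
theorem IsMinimalIdeal.mul_eq_zero {M N : Submodule K A} (hM : IsMinimalIdeal μ M)
    (hN : IsMinimalIdeal μ N) (hne : M ≠ N) {x y : A} (hx : x ∈ M) (hy : y ∈ N) : μ x y = 0 := by
  have hinf : M ⊓ N = ⊥ := by
    rcases hM.eq_bot_or_eq _ (hM.isIdeal.inf hN.isIdeal) inf_le_left with h | h
    · exact h
    rcases hN.eq_bot_or_eq _ (hM.isIdeal.inf hN.isIdeal) inf_le_right with h' | h'
    · exact h'
    · exact absurd (h.symm.trans h') hne
  have : μ x y ∈ M ⊓ N := ⟨hM.isIdeal.mul_mem_right y x hx, hN.isIdeal.mul_mem_left x y hy⟩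
  rwa [hinf, Submodule.mem_bot] at this

/-- A bijective multiplicative map permutes the minimal ideals. -/
theorem IsMinimalIdeal.map {M : Submodule K A} (hM : IsMinimalIdeal μ M)
    (hα : Function.Bijective α) (hmul : ∀ x y, α (μ x y) = μ (α x) (α y)) :
    IsMinimalIdeal μ (M.map α) := by
  refine ⟨⟨?_, ?_⟩, ?_, fun J hJ hJM => ?_⟩
  · rintro a _ ⟨b, hb, rfl⟩
    obtain ⟨a, rfl⟩ := hα.2 a
    exact ⟨μ a b, hM.isIdeal.mul_mem_left a b hb, hmul a b⟩
  · rintro a _ ⟨b, hb, rfl⟩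
    obtain ⟨a, rfl⟩ := hα.2 a
    exact ⟨μ b a, hM.isIdeal.mul_mem_right a b hb, hmul b a⟩
  · intro h
    refine hM.ne_bot (Submodule.map_injective_of_injective hα.1 ?_)
    rw [h, Submodule.map_bot]
  · have hJ' : IsIdeal μ (J.comap α) :=
      ⟨fun a b hb => by
        rw [Submodule.mem_comap, hmul]
        exact hJ.mul_mem_left _ _ hb,
      fun a b hb => by
        rw [Submodule.mem_comap, hmul]
        exact hJ.mul_mem_right _ _ hb⟩
    have hle : J.comap α ≤ M := (Submodule.comap_mono hJM).trans_eq
      (Submodule.comap_map_eq_of_injective hα.1 M)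
    rw [← Submodule.map_comap_eq_of_surjective hα.2 J]
    rcases hM.eq_bot_or_eq _ hJ' hle with h | h
    · left
      rw [h, Submodule.map_bot]
    · right
      rw [h]

/-- If minimal ideals with nonzero multiplication span an algebra, they decompose it into simple
ideals. -/
theorem IsAlternative.exists_isSimpleIdealDecomposition [FiniteDimensional K A]
    (h : IsAlternative μ) (C : Set (Submodule K A)) (hC : ∀ M ∈ C, IsMinimalIdeal μ M)
    (hne : ∀ M ∈ C, ∃ x ∈ M, ∃ y ∈ M, μ x y ≠ 0) (htop : sSup C = ⊤) :
    ∃ (p : ℕ) (S : Fin p → Submodule K A), IsSimpleIdealDecomposition μ S := by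
  -- The intersection of `M` with the sum of the other members of `C` is an ideal annihilated by `M`.
  have hind : sSupIndep C := by
    intro M hM
    have hl : ∀ x ∈ M, ∀ z ∈ sSup (C \ {M}), μ x z = 0 := fun x hx => by
      change sSup (C \ {M}) ≤ LinearMap.ker (μ x)
      exact sSup_le fun N hN z hz => (hC M hM).mul_eq_zero (hC N hN.1) (Ne.symm hN.2) hx hz
    rw [disjoint_iff]
    have hideal : IsIdeal μ (sSup (C \ {M})) := by
      constructor
      · intro a
        change sSup (C \ {M}) ≤ (sSup (C \ {M})).comap (μ a)
        exact sSup_le fun N hN z hz => (le_sSup hN : N ≤ _) ((hC N hN.1).isIdeal.mul_mem_left a z hz)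
      · intro a
        change sSup (C \ {M}) ≤ (sSup (C \ {M})).comap (μ.flip a)
        exact sSup_le fun N hN z hz =>
          (le_sSup hN : N ≤ _) ((hC N hN.1).isIdeal.mul_mem_right a z hz)
    refine ((hC M hM).eq_bot_or_eq _ ((hC M hM).isIdeal.inf hideal) inf_le_left).resolve_right
      fun e => ?_
    obtain ⟨x, hx, y, hy, hxy⟩ := hne M hM
    exact hxy (hl x hx y (inf_eq_left.1 e hy))
  have hfin : C.Finite := WellFoundedGT.finite_of_sSupIndep hind
  have := hfin.to_subtype
  obtain ⟨p, ⟨e⟩⟩ := Finite.exists_equiv_fin C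
  refine ⟨p, fun i => (e.symm i : Submodule K A),
    DirectSum.isInternal_submodule_of_iSupIndep_of_iSup_eq_top
      (((sSupIndep_iff C).1 hind).comp e.symm.injective) ?_, fun i => ?_⟩
  · rw [← htop, sSup_eq_iSup']
    exact e.symm.iSup_comp (g := fun M : C => (M : Submodule K A))
  · generalize e.symm i = M
    obtain ⟨M, hM⟩ := M
    refine ⟨(hC M hM).isIdeal, ⟨fun x y => Subtype.ext (h.left x y),
      fun x y => Subtype.ext (h.right x y)⟩, ?_, fun J hJ => ?_⟩
    · obtain ⟨x, hx, y, hy, hxy⟩ := hne M hM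
      exact derived_ne_bot_iff.2 ⟨⟨x, hx⟩, ⟨y, hy⟩, fun e => hxy (congrArg Subtype.val e)⟩
    -- The other members of `C` annihilate `M`, so an ideal of `M` is an ideal of `A`.
    have hl : ∀ b ∈ J, ∀ a, μ a b ∈ J.map M.subtype := fun b hb a => by
      have : sSup C ≤ (J.map M.subtype).comap (μ.flip b) := sSup_le fun N hN a ha => by
        change μ a b ∈ J.map M.subtype
        by_cases hMN : N = M
        · subst hMN
          exact ⟨_, hJ.mul_mem_left ⟨a, ha⟩ b hb, rfl⟩
        · rw [(hC N hN).mul_eq_zero (hC M hM) hMN ha b.2]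
          exact Submodule.zero_mem _
      exact this (htop ▸ Submodule.mem_top)
    have hr : ∀ b ∈ J, ∀ a, μ b a ∈ J.map M.subtype := fun b hb a => by
      have : sSup C ≤ (J.map M.subtype).comap (μ b) := sSup_le fun N hN a ha => by
        change μ b a ∈ J.map M.subtype
        by_cases hMN : N = M
        · subst hMN
          exact ⟨_, hJ.mul_mem_right ⟨a, ha⟩ b hb, rfl⟩
        · rw [(hC M hM).mul_eq_zero (hC N hN) (Ne.symm hMN) b.2 ha]
          exact Submodule.zero_mem _
      exact this (htop ▸ Submodule.mem_top)
    have hJ' : IsIdeal μ (J.map M.subtype) := by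
      refine ⟨?_, ?_⟩
      · rintro a _ ⟨b, hb, rfl⟩
        exact hl b hb a
      · rintro a _ ⟨b, hb, rfl⟩
        exact hr b hb a
    rcases (hC M hM).eq_bot_or_eq _ hJ' (Submodule.map_subtype_le M J) with h₀ | h₁
    · exact Or.inl (Submodule.map_injective_of_injective M.injective_subtype
        (h₀.trans (Submodule.map_bot _).symm))
    · right
      rw [← Submodule.comap_map_eq_of_injective M.injective_subtype J, h₁,
        Submodule.comap_subtype_self]

/-- The induced algebra of a semisimple Hom-alternative algebra is semisimple, because it is the sum
of those minimal ideals that lie in some `S i`. -/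
theorem IsSemisimpleHomAlternative.isSemisimpleAlternative [FiniteDimensional K A]
    (h : IsSemisimpleHomAlternative μ α) (hμ : IsInducedAlternative μ α μ') :
    IsSemisimpleAlternative μ' := by
  have hα := h.bijective
  have hmul := (h.homAlternative.untwist hα.1 hμ.eq_comp).1
  have hmulμ := h.homAlternative.multiplicative
  obtain ⟨p, S, hS⟩ := h.exists_decomposition
  have hSα : ∀ i, (S i).map α = S i := fun i => (hS.simple i).map_eq hmulμ
  have mem : ∀ i x, α x ∈ S i → x ∈ S i := fun i x hx => by
    obtain ⟨y, hy, hyx⟩ : α x ∈ (S i).map α := by rwa [hSα]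
    exact hα.1 hyx ▸ hy
  have hSideal : ∀ i, IsIdeal μ' (S i) := fun i => by
    obtain ⟨hid, -⟩ := hS.simple i
    refine ⟨fun a b hb => mem i _ ?_, fun a b hb => mem i _ ?_⟩
    · rw [← hμ.eq_comp]
      exact hid.mul_mem_left a b hb
    · rw [← hμ.eq_comp]
      exact hid.mul_mem_right a b hb
  set C : Set (Submodule K A) := {M | IsMinimalIdeal μ' M ∧ ∃ i, M ≤ S i}
  have hCα : ∀ M ∈ C, M.map α ∈ C := by
    rintro M ⟨hM, i, hi⟩
    exact ⟨hM.map hα hmul, i, (Submodule.map_mono hi).trans_eq (hSα i)⟩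
  -- The sum of the minimal ideals is stable under `α`, hence contains every `S i`.
  have hsupα : ∀ b ∈ sSup C, α b ∈ sSup C := by
    change sSup C ≤ (sSup C).comap α
    exact sSup_le fun M hM x hx =>
      (le_sSup (hCα M hM) : M.map α ≤ _) (Submodule.mem_map_of_mem hx)
  have htop : sSup C = ⊤ := by
    rw [eq_top_iff, ← hS.isInternal.submodule_iSup_eq_top]
    refine iSup_le fun i => ?_
    obtain ⟨hid, -⟩ := id (hS.simple i)
    have hl : ∀ a, ∀ b ∈ sSup C, μ a b ∈ sSup C := fun a => by
      change sSup C ≤ (sSup C).comap (μ a)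
      refine sSup_le fun M hM x hx => ?_
      rw [Submodule.mem_comap, hμ.eq_comp]
      exact hsupα _ ((le_sSup hM : M ≤ _) (hM.1.isIdeal.mul_mem_left a x hx))
    have hr : ∀ a, ∀ b ∈ sSup C, μ b a ∈ sSup C := fun a => by
      change sSup C ≤ (sSup C).comap (μ.flip a)
      refine sSup_le fun M hM x hx => ?_
      rw [Submodule.mem_comap, LinearMap.flip_apply, hμ.eq_comp]
      exact hsupα _ ((le_sSup hM : M ≤ _) (hM.1.isIdeal.mul_mem_right a x hx))
    refine inf_eq_left.1 (((hS.simple i).eq_bot_or_eq (J := S i ⊓ sSup C) inf_le_left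
      (fun a _ b hb => ⟨hid.mul_mem_left a b hb.1, hl a b hb.2⟩)
      (fun a _ b hb => ⟨hid.mul_mem_right a b hb.1, hr a b hb.2⟩)
      fun b hb => ⟨hid.twist_mem b hb.1, hsupα b hb.2⟩).resolve_left fun hbot => ?_)
    obtain ⟨M, hMS, hM⟩ := (hSideal i).exists_isMinimalIdeal (hS.simple i).ne_bot
    exact hM.ne_bot (eq_bot_iff.2 (hbot ▸ le_inf hMS (le_sSup ⟨hM, i, hMS⟩)))
  refine ⟨hμ.alternative, ?_,
    hμ.alternative.exists_isSimpleIdealDecomposition C (fun M hM => hM.1) ?_ htop⟩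
  · by_contra hA
    rw [not_nontrivial_iff_subsingleton] at hA
    exact h.twist_ne_zero (Subsingleton.elim _ _)
  -- A minimal ideal `M ≤ S i` with zero multiplication would annihilate all minimal ideals and
  -- so lie in the annihilator of `S i`, which is a proper Hom-ideal.
  rintro M ⟨hM, i, hMS⟩
  by_contra! hzero
  obtain ⟨hid, -⟩ := id (hS.simple i)
  have hl : ∀ x ∈ M, ∀ y, μ' x y = 0 := fun x hx y => by
    have : sSup C ≤ LinearMap.ker (μ' x) := sSup_le fun N hN y hy => by
      by_cases hMN : M = N
      · subst hMN
        exact hzero x hx y hy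
      · exact hM.mul_eq_zero hN.1 hMN hx hy
    exact this (htop ▸ Submodule.mem_top)
  have hr : ∀ x ∈ M, ∀ y, μ' y x = 0 := fun x hx y => by
    have : sSup C ≤ LinearMap.ker (μ'.flip x) := sSup_le fun N hN y hy => by
      by_cases hMN : M = N
      · subst hMN
        exact hzero y hy x hx
      · exact hN.1.mul_eq_zero hM (Ne.symm hMN) hy hx
    exact this (htop ▸ Submodule.mem_top)
  set Z : Submodule K A := LinearMap.ker μ ⊓ LinearMap.ker μ.flip with hZ
  have memZ : ∀ x, x ∈ Z ↔ (∀ y, μ x y = 0) ∧ ∀ y, μ y x = 0 := fun x => by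
    rw [hZ, Submodule.mem_inf, LinearMap.mem_ker, LinearMap.mem_ker, LinearMap.ext_iff,
      LinearMap.ext_iff]
    rfl
  rcases (hS.simple i).eq_bot_or_eq (J := S i ⊓ Z) inf_le_left
    (fun a _ b hb => by rw [((memZ b).1 hb.2).2]; exact Submodule.zero_mem _)
    (fun a _ b hb => by rw [((memZ b).1 hb.2).1]; exact Submodule.zero_mem _)
    (fun b hb => by
      refine ⟨hid.twist_mem b hb.1, (memZ _).2 ⟨fun y => ?_, fun y => ?_⟩⟩ <;>
        obtain ⟨y, rfl⟩ := hα.2 y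
      · rw [← hmulμ, ((memZ b).1 hb.2).1, map_zero]
      · rw [← hmulμ, ((memZ b).1 hb.2).2, map_zero]) with hbot | heq
  · refine hM.ne_bot (eq_bot_iff.2 (hbot ▸ le_inf hMS fun x hx => (memZ x).2 ⟨fun y => ?_,
      fun y => ?_⟩))
    · rw [hμ.eq_comp, hl x hx, map_zero]
    · rw [hμ.eq_comp, hr x hx, map_zero]
  · obtain ⟨x, hx, y, -, hxy⟩ := (hS.simple i).exists_mul_ne_zero
    exact hxy (((memZ x).1 (inf_eq_left.1 heq hx)).1 y)

end HomAlg

/-! ### Semisimple Hom-alternative algebras -/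

theorem mainTheorem2 {K : Type*} [Field K] [CharZero K]
    {A : Type*} [AddCommGroup A] [Module K A] :
    (∀ (μ : A →ₗ[K] A →ₗ[K] A) (α : A →ₗ[K] A),
      FiniteDimensional K A →
      HomAlg.IsSemisimpleHomAlternative μ α →
        Function.Bijective α ∧
        HomAlg.IsOfAlternativeType μ α ∧
        ∀ μ' : A →ₗ[K] A →ₗ[K] A, HomAlg.IsInducedAlternative μ α μ' →
          HomAlg.IsSemisimpleAlternative μ') ∧
    (∀ (μ' : A →ₗ[K] A →ₗ[K] A) (s : ℕ) (S : Fin s → Submodule K A) (α : A ≃ₗ[K] A),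
      HomAlg.IsSemisimpleAlternative μ' →
      HomAlg.IsSimpleIdealDecomposition μ' S →
      (∀ x y, α (μ' x y) = μ' (α x) (α y)) →
      (∀ i, (S i).map (α : A →ₗ[K] A) = S i) →
        HomAlg.IsSemisimpleHomAlternative (μ'.compr₂ (α : A →ₗ[K] A)) (α : A →ₗ[K] A) ∧
        HomAlg.IsSimpleHomIdealDecomposition (μ'.compr₂ (α : A →ₗ[K] A)) (α : A →ₗ[K] A) S ∧
        ∀ (t : ℕ) (T : Fin t → Submodule K A),
          HomAlg.IsSimpleHomIdealDecomposition (μ'.compr₂ (α : A →ₗ[K] A)) (α : A →ₗ[K] A) T →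
            ∃ e : Fin t ≃ Fin s, ∀ j, T j = S (e j)) := by
  refine ⟨fun μ α _ h => ?_, fun μ' s S α h hS hmul hSα => ?_⟩
  · have hα := h.bijective
    refine ⟨hα, ?_, fun μ' hμ => h.isSemisimpleAlternative hμ⟩
    have hμ : ∀ x y, μ x y =
        α ((μ.compr₂ (LinearEquiv.ofBijective α hα).symm.toLinearMap) x y) := fun x y =>
      ((LinearEquiv.ofBijective α hα).apply_symm_apply (μ x y)).symm
    exact ⟨_, (h.homAlternative.untwist hα.1 hμ).2, hμ⟩
  · have hdec : HomAlg.IsSimpleHomIdealDecomposition (μ'.compr₂ (α : A →ₗ[K] A))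
        (α : A →ₗ[K] A) S :=
      ⟨hS.isInternal, fun i => (hS.simple i).isSimpleHomIdeal α.injective hmul (hSα i)⟩
    refine ⟨⟨h.alternative.isHomAlternative hmul, fun h₀ => ?_, s, S, hdec⟩, hdec,
      fun t T hT => hdec.unique hT⟩
    obtain ⟨x, hx⟩ := @exists_ne _ h.nontrivial (0 : A)
    exact (map_ne_zero_iff α α.injective).2 hx (LinearMap.congr_fun h₀ x)
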